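/- Let $\mathbf r=(r_n)_{n\ge 1}$ be integers, only finitely many of them nonzero. Put $f(\tau)=\prod_{n}\eta(n\tau)^{r_n}$ for $\Im\tau>0$, where $\eta$ is the Dedekind eta function, $k=\frac12\sum_n r_n$ (the weight), $N=\operatorname{lcm}\{n: r_n\neq 0\}$ (the level; $N=1$ if all $r_n=0$), $x_N=\sum_{n\mid N} n r_n$ and $\varPi=\prod_{n\mid N}(N/n)^{|r_n|}$. Let $\delta=0$ if $\varPi=2^\alpha(4m+1)$ and $\delta=1$ if $\varPi=2^\alpha(4m+3)$ with integers $\alpha,m\ge 0$. For $\gamma=\begin{pmatrix}a&b\\c&d\end{pmatrix}\in \mathrm{SL}_2(\mathbb Z)$ and $\epsilon=\pm1$ let $g|_k(\gamma,\epsilon)(\tau)=(\epsilon\sqrt{c\tau+d})^{-2k}g\left(\frac{a\tau+b}{c\tau+d}\right)$ with the principal square root. Let $\chi$ be the character of $f$, i.e. $f|_k(\gamma,\epsilon)=\chi(\gamma,\epsilon)f$ for $\gamma\in\Gamma_0(N)$, $\epsilon=\pm1$. Let $M_k(\Gamma_0(N),\chi)$ be the space of holomorphic functions $g$ on the upper half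 plane with $g|_k(\gamma,\epsilon)=\chi(\gamma,\epsilon)g$ for all $\gamma\in\Gamma_0(N)$, $\epsilon=\pm1$, such that $g|_k(\gamma,\epsilon)$ is bounded at $i\infty$ for all $\gamma\in\mathrm{SL}_2(\mathbb Z)$, $\epsilon=\pm1$; let $S_k(\Gamma_0(N),\chi)$ be the subspace of those $g$ for which all $g|_k(\gamma,\epsilon)$ vanish at $i\infty$. Suppose that $f$ is weakly admissible: $f|_k(\gamma,\epsilon)$ is bounded at $i\infty$ for all $\gamma\in\mathrm{SL}_2(\mathbb Z)$, $\epsilon=\pm1$, and either $\dim M_k(\Gamma_0(N),\chi)=1$, or $\dim M_k(\Gamma_0(N),\chi)\ge 2$, $\dim S_k(\Gamma_0(N),\chi)=1$ and $f\in S_k(\Gamma_0(N),\chi)$. Suppose moreover that $k\in\mathbb Z$ and $x_N'=x_N/24\in\mathbb Z_{\ge 0}$. Then $f(\tau)=\sum_{n\ge 0}c_f(n)q^n$ with $q=e^{2\pi i\tau}$, where $c_f(n)\in\mathbb C$. Let $m_f=24/\gcd\left(24,\sum_{n\mid N}(N/n)r_n,\sum_{n\mid N}nr_n\right)$ and $L_f=\{l\in\mathbb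 Z_{\ge1}: l\equiv 1 \bmod m_f\}$. Let $l_1,l_2\in L_f$ satisfy $\gcd(l_1,l_2)=\gcd(l_1,x_N')=\gcd(l_2,x_N')=1$, and suppose that for every prime $p\nmid N$ neither $l_1$ nor $l_2$ is divisible by $p^2$. If $N$ is even and $N(k+\delta)\equiv 2\bmod 4$, suppose in addition that $l_1$ and $l_2$ are odd. Then $$c_f(l_1x_N')\,c_f(l_2x_N')=\varepsilon\,c_f(l_1l_2x_N'),\qquad \varepsilon=u_{l_1}u_{l_2}u_{l_1l_2},$$ where $$u_l=\begin{cases}1,&\text{if } 2\mid l \text{ and } (2\nmid N \text{ or } 4\mid N(k+\delta)),\\ 1,&\text{if } 2\nmid l \text{ and } 4\mid N(k+\delta)(l-1),\\ -1,&\text{if } 2\nmid l\text{ and } 4\nmid N(k+\delta)(l-1).\end{cases}$$ -/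

import Mathlib

open scoped MatrixGroups Manifold

noncomputable section

namespace EtaQuotient

open UpperHalfPlane

/-! ### Half-integral weight forms on `Γ₀(N)` and the double cover

The weight `k ∈ ½ℤ` is recorded through the integer `w = 2k`.  An element of the double cover of
`SL₂(ℤ)` is a pair `(γ, ε)` with `γ ∈ SL₂(ℤ)` and a sign `ε = ±1`; the pair stands for the branch
`ε √(cτ + d)` of the square root, `√` being the principal one. -/

/-- The slash operator of weight `k = w / 2` of the double cover of `SL₂(ℤ)`:
`(g |ₖ (γ, ε)) (τ) = (ε √(cτ + d)) ^ (-2k) * g (γ τ)`, as a linear map in `g`. -/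
def slash (w : ℤ) (γ : SL(2, ℤ)) (ε : ℤˣ) : (ℍ → ℂ) →ₗ[ℂ] (ℍ → ℂ) where
  toFun g τ :=
    ((((ε : ℤ) : ℂ)) * (((γ 1 0 : ℤ) : ℂ) * (τ : ℂ) + ((γ 1 1 : ℤ) : ℂ)) ^ (1 / 2 : ℂ)) ^ (-w)
      * g (γ • τ)
  map_add' g h := by
    funext τ
    simp [mul_add]
  map_smul' a g := by
    funext τ
    simp [mul_left_comm]

/-- The space `M_k(Γ₀(N), χ)`, `k = w / 2`, for a function `χ` on the double cover: the holomorphic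
functions `g` on the upper half plane such that `g |ₖ (γ, ε) = χ(γ, ε) g` for all `γ ∈ Γ₀(N)` and
`ε = ±1`, and such that `g |ₖ (γ, ε)` is bounded at `i∞` for all `γ ∈ SL₂(ℤ)` and `ε = ±1`. -/
def modularForms (N : ℕ) (w : ℤ) (χ : SL(2, ℤ) → ℤˣ → ℂ) : Submodule ℂ (ℍ → ℂ) where
  carrier := {g | MDiff g ∧
    (∀ γ ∈ CongruenceSubgroup.Gamma0 N, ∀ ε : ℤˣ, slash w γ ε g = χ γ ε • g) ∧
    ∀ (γ : SL(2, ℤ)) (ε : ℤˣ), IsBoundedAtImInfty (slash w γ ε g)}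
  add_mem' := by
    rintro g h ⟨hg1, hg2, hg3⟩ ⟨hh1, hh2, hh3⟩
    refine ⟨hg1.add hh1, fun γ hγ ε => ?_, fun γ ε => ?_⟩
    · rw [map_add, hg2 γ hγ ε, hh2 γ hγ ε, smul_add]
    · rw [map_add]
      exact (boundedAtImInftySubalgebra ℂ).add_mem (hg3 γ ε) (hh3 γ ε)
  zero_mem' := by
    refine ⟨mdifferentiable_const, fun γ hγ ε => by simp, fun γ ε => ?_⟩
    rw [map_zero]
    exact (boundedAtImInftySubalgebra ℂ).zero_mem
  smul_mem' := by
    rintro a g ⟨hg1, hg2, hg3⟩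
    refine ⟨hg1.const_smul a, fun γ hγ ε => ?_, fun γ ε => ?_⟩
    · rw [map_smul, hg2 γ hγ ε, smul_comm]
    · rw [map_smul]
      exact (boundedAtImInftySubalgebra ℂ).smul_mem (hg3 γ ε) a

/-- The space `S_k(Γ₀(N), χ)`, `k = w / 2`, of cusp forms: the `g ∈ M_k(Γ₀(N), χ)` such that
`g |ₖ (γ, ε)` tends to zero at `i∞` for all `γ ∈ SL₂(ℤ)` and `ε = ±1`. -/
def cuspForms (N : ℕ) (w : ℤ) (χ : SL(2, ℤ) → ℤˣ → ℂ) : Submodule ℂ (ℍ → ℂ) where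
  carrier := {g | g ∈ modularForms N w χ ∧
    ∀ (γ : SL(2, ℤ)) (ε : ℤˣ), IsZeroAtImInfty (slash w γ ε g)}
  add_mem' := by
    rintro g h ⟨hg1, hg2⟩ ⟨hh1, hh2⟩
    refine ⟨add_mem hg1 hh1, fun γ ε => ?_⟩
    rw [map_add]
    exact (zeroAtImInftySubmodule ℂ).add_mem (hg2 γ ε) (hh2 γ ε)
  zero_mem' := by
    refine ⟨zero_mem _, fun γ ε => ?_⟩
    rw [map_zero]
    exact (zeroAtImInftySubmodule ℂ).zero_mem
  smul_mem' := by
    rintro a g ⟨hg1, hg2⟩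
    refine ⟨Submodule.smul_mem _ a hg1, fun γ ε => ?_⟩
    rw [map_smul]
    exact (zeroAtImInftySubmodule ℂ).smul_mem a (hg2 γ ε)

/-! ### Eta-quotients

An eta-quotient `∏ η(nτ) ^ rₙ` is given by its finitely supported exponent function `r`. -/

/-- The eta-quotient `f(τ) = ∏ₙ η(nτ) ^ rₙ`. -/
def etaQuotient (r : ℕ+ →₀ ℤ) (τ : ℍ) : ℂ :=
  r.prod fun n e => ModularForm.eta (((n : ℕ) : ℂ) * (τ : ℂ)) ^ e

/-- The level `N`: the least common multiple of the `n` with `rₙ ≠ 0` (it is `1` if `r = 0`). -/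
def level (r : ℕ+ →₀ ℤ) : ℕ := r.support.lcm fun n => (n : ℕ)

/-- Twice the weight, `2k = ∑ rₙ`. -/
def twoWeight (r : ℕ+ →₀ ℤ) : ℤ := r.sum fun _ e => e

/-- The weight `k = ½ ∑ rₙ`. -/
def weight (r : ℕ+ →₀ ℤ) : ℚ := (twoWeight r : ℚ) / 2

/-- `x_N = ∑ n rₙ`, so that the expansion of `f` at `i∞` starts with `q ^ (x_N / 24)`. -/
def xN (r : ℕ+ →₀ ℤ) : ℤ := r.sum fun n e => ((n : ℕ) : ℤ) * e

/-- `x₁ = ∑ (N / n) rₙ`; the divisions are exact. -/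
def xOne (r : ℕ+ →₀ ℤ) : ℤ := r.sum fun n e => ((level r / (n : ℕ) : ℕ) : ℤ) * e

/-- The character of the eta-quotient `f` on the double cover of `Γ₀(N)`, that is, the constant
`χ(γ, ε)` with `f |ₖ (γ, ε) = χ(γ, ε) f`.  As `f` has no zero, it can be read off at the point
`τ = i`. -/
def character (r : ℕ+ →₀ ℤ) (γ : SL(2, ℤ)) (ε : ℤˣ) : ℂ :=
  slash (twoWeight r) γ ε (etaQuotient r) I / etaQuotient r I

/-- The eta-quotient is holomorphic (at all cusps): the order at `i∞` of `f |ₖ γ` is nonnegative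
for all `γ` in the double cover of `SL₂(ℤ)`. -/
def IsHolomorphic (r : ℕ+ →₀ ℤ) : Prop :=
  ∀ (γ : SL(2, ℤ)) (ε : ℤˣ), IsBoundedAtImInfty (slash (twoWeight r) γ ε (etaQuotient r))

/-- Weakly admissible eta-quotients: holomorphic eta-quotients `f` of weight `k`, level `N` and
character `χ` such that either `dim M_k(Γ₀(N), χ) = 1`, or `dim M_k(Γ₀(N), χ) ≥ 2`,
`dim S_k(Γ₀(N), χ) = 1` and `f` is a cusp form. -/
def IsWeaklyAdmissible (r : ℕ+ →₀ ℤ) : Prop :=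
  IsHolomorphic r ∧
    (Module.rank ℂ (modularForms (level r) (twoWeight r) (character r)) = 1 ∨
      (2 ≤ Module.rank ℂ (modularForms (level r) (twoWeight r) (character r)) ∧
        Module.rank ℂ (cuspForms (level r) (twoWeight r) (character r)) = 1 ∧
        etaQuotient r ∈ cuspForms (level r) (twoWeight r) (character r)))

/-- The Fourier coefficient `c_f(n)`, `n = 0, 1, 2, …`, of an eta-quotient whose expansion at `i∞`
runs over nonnegative integral powers of `q = exp(2πiτ)`. -/
def fourierCoeff (r : ℕ+ →₀ ℤ) (n : ℕ) : ℂ := (qExpansion 1 (etaQuotient r)).coeff n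

/-- `m_f = 24 / gcd(24, ∑ (N / n) rₙ, ∑ n rₙ)`. -/
def mf (r : ℕ+ →₀ ℤ) : ℕ := 24 / Nat.gcd 24 (Int.gcd (xOne r) (xN r))

/-- The monoid `L_f`: the `l ≥ 1` with `l ≡ 1 mod m_f`, which have moreover to be perfect squares
if the weight is not an integer. -/
def Lf (r : ℕ+ →₀ ℤ) : Set ℕ :=
  {l | 1 ≤ l ∧ l ≡ 1 [MOD mf r] ∧ (Odd (twoWeight r) → IsSquare l)}

/-- `Π = ∏ (N / n) ^ |rₙ|`. -/
def bigPi (r : ℕ+ →₀ ℤ) : ℕ := r.prod fun n e => (level r / (n : ℕ)) ^ e.natAbs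

open Classical in
/-- `δ = 1` if `Π` has the form `2 ^ α * (4m + 3)`, and `δ = 0` if it has the form
`2 ^ α * (4m + 1)`. -/
def delta (r : ℕ+ →₀ ℤ) : ℤ := if ∃ α m : ℕ, bigPi r = 2 ^ α * (4 * m + 3) then 1 else 0

/-- The sign `u_l` for a form of level `N`, with `s = k + δ`: it is `-1` if `l` is odd and
`4 ∤ N (k + δ) (l - 1)`, and `1` if `l` is odd and `4 ∣ N (k + δ) (l - 1)`, or if `l` is even and
`2 ∤ N` or `4 ∣ N (k + δ)`.  The remaining case, `l` and `N` even and `4 ∤ N (k + δ)`, is excluded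
wherever the sign is used; it gets the value `1` here. -/
def uSign (N : ℕ) (s : ℤ) (l : ℕ) : ℤ :=
  if ¬ 2 ∣ l ∧ ¬ (4 : ℤ) ∣ (N : ℤ) * s * ((l : ℤ) - 1) then -1 else 1

end EtaQuotient

end

open scoped MatrixGroups Manifold

noncomputable section

namespace EtaQuotient

open UpperHalfPlane
open scoped NumberTheorySymbols

/-! ### The multiplier of the Dedekind eta function -/

/-! Put h(τ) = f(τ/l)/f(τ). The Hecke image T_l f used here is f times the sum of the translates of
h over the cosets, in Γ₀(N), of the subgroup leaving h invariant. Dividing by f turns the summands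
into honest functions, so the trace is Γ₀(N)-invariant and T_l f has the character of f. Every
translate of a summand to a cusp is a multiple of (f|γ')((aτ+b)/d) with ad = l, so T_l f is bounded
at the cusps, and vanishes there if f does. Weak admissibility then puts f and T_l f in a common
one-dimensional space: T_l f = c f (`exists_hecke_eq_smul`).

Compare coefficients at an exponent n prime to l. A coset whose inverse representative has upper
left entry prime to l gives f((τ+b)/l) and contributes c_f(ln). Any other coset gives exponents
divisible by a², a > 1, and contributes nothing because of the condition on squares. Hence c·c_f(n)
= K·c_f(ln) with K ≠ 0 (`exists_fourierCoeff_relation`). For l = l₁, taking n = x (where c_f(x) = 1,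
`fourierCoeff_leading`) and n = l₂x gives the product formula without any sign; indeed ε is always 1
(`uSign_mul_uSign`).

The sum is finite because f(lτ)/f(τ) is invariant under Γ₀(Nl) (`Gamma0_le_invariance`). This rests
on the explicit multiplier of η (`eta_moebius`): the condition l ≡ 1 mod m_f removes the 24th roots
of unity, and the integral weight removes the Jacobi symbols, whose product is (l/d)^(2k) = 1. -/

/-- The root of unity `exp (2πi m / 24)`. -/
def zeta24 (m : ℤ) : ℂ := Complex.exp (2 * Real.pi * Complex.I * m / 24)

lemma zeta24_add (m n : ℤ) : zeta24 (m + n) = zeta24 m * zeta24 n := by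
  rw [zeta24, zeta24, zeta24, ← Complex.exp_add]
  congr 1
  push_cast
  ring

lemma zeta24_ne_zero (m : ℤ) : zeta24 m ≠ 0 := Complex.exp_ne_zero _

lemma zeta24_zero : zeta24 0 = 1 := by simp [zeta24]

lemma zeta24_mul_24 (m : ℤ) : zeta24 (24 * m) = 1 := by
  rw [zeta24, Complex.exp_eq_one_iff]
  exact ⟨m, by push_cast; ring⟩

lemma zeta24_twelve : zeta24 12 = -1 := by
  rw [zeta24, ← Complex.exp_pi_mul_I]
  congr 1
  push_cast
  ring

lemma zeta24_eq_of_dvd {m n : ℤ} (h : (24 : ℤ) ∣ m - n) : zeta24 m = zeta24 n := by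
  obtain ⟨t, ht⟩ := h
  rw [show m = n + 24 * t by lia, zeta24_add, zeta24_mul_24, mul_one]

lemma zeta24_mul_nat (m : ℤ) (n : ℕ) : zeta24 (n * m) = zeta24 m ^ n := by
  rw [zeta24, zeta24, ← Complex.exp_nat_mul]
  congr 1
  push_cast
  ring

lemma zeta24_neg (m : ℤ) : zeta24 (-m) = (zeta24 m)⁻¹ := by
  rw [zeta24, zeta24, ← Complex.exp_neg]
  congr 1
  push_cast
  ring

lemma zeta24_mul (m n : ℤ) : zeta24 (n * m) = zeta24 m ^ n := by
  rw [zeta24, zeta24, ← Complex.exp_int_mul]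
  congr 1
  push_cast
  ring

lemma neg_one_pow_eq_zeta24 (s : ℕ) : ((-1 : ℂ)) ^ s = zeta24 (s * 12) := by
  rw [zeta24_mul_nat, zeta24_twelve]

lemma eta_add_one (z : ℂ) : ModularForm.eta (z + 1) = zeta24 1 * ModularForm.eta z := by
  have h1 : Function.Periodic.qParam 24 (z + 1) = zeta24 1 * Function.Periodic.qParam 24 z := by
    rw [Function.Periodic.qParam, Function.Periodic.qParam, zeta24, ← Complex.exp_add]
    congr 1
    push_cast
    ring
  have h2 : Function.Periodic.qParam 1 (z + 1) = Function.Periodic.qParam 1 z := by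
    have := (Complex.exp_periodic) (2 * Real.pi * Complex.I * z)
    simp only [Function.Periodic.qParam, Complex.ofReal_one, div_one, mul_add, mul_one] at this ⊢
    exact this
  simp only [ModularForm.eta, ModularForm.eta_q, h1, h2, mul_assoc]

lemma eta_add_int (z : ℂ) (m : ℤ) :
    ModularForm.eta (z + m) = zeta24 m * ModularForm.eta z := by
  induction m using Int.induction_on with
  | zero => simp [zeta24_zero]
  | succ i ih =>
    rw [zeta24_add, mul_comm (zeta24 _), mul_assoc, ← ih, ← eta_add_one]
    push_cast
    ring_nf
  | pred i ih =>
    have h := eta_add_one (z + ((-i - 1 : ℤ) : ℂ))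
    rw [show z + ((-i - 1 : ℤ) : ℂ) + 1 = z + ((-i : ℤ) : ℂ) by push_cast; ring, ih,
      show zeta24 (-i) = zeta24 1 * zeta24 (-i - 1) by rw [← zeta24_add]; congr 1; ring,
      mul_assoc] at h
    exact (mul_left_cancel₀ (zeta24_ne_zero 1) h).symm

/-! ### Principal square roots, and η under (1 0; 1 1) -/

lemma sqrt_mul_of_im {z w : ℂ} (hz : 0 ≤ z.im) (hw : 0 ≤ w.im) (h : 0 < (z * w).im) :
    Complex.sqrt (z * w) = Complex.sqrt z * Complex.sqrt w := by
  have hz0 : z ≠ 0 := by rintro rfl; simp at h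
  have hw0 : w ≠ 0 := by rintro rfl; simp at h
  have h1 := Complex.arg_nonneg_iff.mpr hz
  have h2 := Complex.arg_nonneg_iff.mpr hw
  have h3 := Complex.arg_le_pi z
  have h4 := Complex.arg_le_pi w
  -- Both arguments lie in [0, π]; a sum beyond π would have nonpositive sine, against Im(zw) > 0.
  -- So the logarithms add without a jump.
  have hle : z.arg + w.arg ≤ Real.pi := by
    by_contra! hlt
    have hs : Real.sin (z.arg + w.arg) ≤ 0 := by
      have := Real.sin_nonneg_of_nonneg_of_le_pi (x := z.arg + w.arg - Real.pi)
        (by linarith) (by linarith)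
      rw [Real.sin_sub_pi] at this
      linarith
    have him : (z * w).im = ‖z‖ * ‖w‖ * Real.sin (z.arg + w.arg) := by
      conv_lhs => rw [← Complex.norm_mul_exp_arg_mul_I z, ← Complex.norm_mul_exp_arg_mul_I w]
      rw [show (‖z‖ : ℂ) * Complex.exp (z.arg * Complex.I) *
        (‖w‖ * Complex.exp (w.arg * Complex.I)) =
        ((‖z‖ * ‖w‖ : ℝ) : ℂ) * Complex.exp (((z.arg + w.arg : ℝ) : ℂ) * Complex.I) by
          push_cast
          rw [add_mul, Complex.exp_add]
          ring]
      rw [Complex.im_ofReal_mul, Complex.exp_ofReal_mul_I_im]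
    have := mul_nonneg (norm_nonneg z) (norm_nonneg w)
    nlinarith
  rw [sqrt_eq_exp (mul_ne_zero hz0 hw0), sqrt_eq_exp hz0, sqrt_eq_exp hw0,
    Complex.log_mul hz0 hw0 ⟨by linarith [Real.pi_pos], hle⟩, ← Complex.exp_add]
  congr 1
  ring

lemma sqrt_ne_zero {z : ℂ} (hz : z ≠ 0) : Complex.sqrt z ≠ 0 := by
  rw [sqrt_eq_exp hz]
  exact Complex.exp_ne_zero _

lemma sqrt_zpow_two_mul {z : ℂ} (hz : z ≠ 0) (k : ℤ) : Complex.sqrt z ^ (2 * k) = z ^ k := by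
  rw [zpow_mul, sqrt_eq_exp hz, zpow_ofNat, ← Complex.exp_nat_mul]
  rw [show ((2 : ℕ) : ℂ) * (Complex.log z / 2) = Complex.log z by push_cast; ring,
    Complex.exp_log hz]

lemma im_div_add_one_pos {z : ℂ} (hz : 0 < z.im) : 0 < (z / (z + 1)).im := by
  have h0 : 0 < Complex.normSq (z + 1) := by
    rw [Complex.normSq_pos]
    intro h
    have := congrArg Complex.im h
    simp at this
    exact hz.ne' this
  rw [Complex.div_im, ← sub_div]
  apply div_pos _ h0
  simp
  nlinarith

lemma add_one_ne_zero_of_im {z : ℂ} (hz : 0 < z.im) : z + 1 ≠ 0 := by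
  intro h
  have := congrArg Complex.im h
  simp at this
  exact hz.ne' this

lemma ne_zero_of_im {z : ℂ} (hz : 0 < z.im) : z ≠ 0 := by
  rintro rfl
  simp at hz

/-- (1 0; 1 1) is conjugate to T⁻¹ under inversion: -1/(z/(z+1)) + 1 = -1/z. The inversion law at z
and at z/(z+1) therefore reduces the claim to η(z+1). -/
lemma eta_div_add_one {z : ℂ} (hz : 0 < z.im) :
    ModularForm.eta (z / (z + 1)) = zeta24 (-1) * Complex.sqrt (z + 1) * ModularForm.eta z := by
  have hz0 := ne_zero_of_im hz
  have hz1 := add_one_ne_zero_of_im hz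
  have hw := im_div_add_one_pos hz
  have h1 := ModularForm.eta_comp_eq_csqrt_I_inv (show z ∈ upperHalfPlaneSet from hz)
  have h2 := ModularForm.eta_comp_eq_csqrt_I_inv (show z / (z + 1) ∈ upperHalfPlaneSet from hw)
  simp only [Function.comp_apply, Pi.smul_apply, Pi.mul_apply, smul_eq_mul] at h1 h2
  have h3 := eta_add_one (-1 / (z / (z + 1)))
  rw [show -1 / (z / (z + 1)) + 1 = -1 / z by field_simp; ring, h1, h2] at h3
  have h4 : Complex.sqrt z = Complex.sqrt (z / (z + 1)) * Complex.sqrt (z + 1) := by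
    rw [← sqrt_mul_of_im hw.le (by simpa using hz.le) (by rwa [div_mul_cancel₀ _ hz1]),
      div_mul_cancel₀ _ hz1]
  rw [h4] at h3
  have hI := sqrt_ne_zero Complex.I_ne_zero
  have hs := sqrt_ne_zero (div_ne_zero hz0 hz1)
  rw [zeta24_neg]
  have := zeta24_ne_zero 1
  field_simp at h3 ⊢
  linear_combination -h3

/-- The multiplier of `η` under a matrix of determinant one with entries in `ℕ`. -/
def etaMultiplier (a b c d : ℕ) : ℂ :=
  -- Petersson's classical formula. Nonnegative entries spare the usual sign corrections; for even c
  -- the determinant makes d odd, so the lower argument of the Jacobi symbol is odd in both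
  -- branches.
  if Odd c then
    (J(d | c) : ℂ) * zeta24 (c * (a + d) - b * d * (c ^ 2 - 1) - 3 * c)
  else
    (J(c | d) : ℂ) * zeta24 (a * c * (1 - d ^ 2) + d * (b - c + 3) - 3)

/-! ### The multiplier formula under the two generators -/

lemma jacobiSym_add_left (d c : ℕ) : J(((c + d : ℕ) : ℤ) | c) = J(d | c) := by
  apply jacobiSym.mod_left'
  push_cast
  simp

lemma jacobiSym_add_left' (d c : ℕ) : J(((c + d : ℕ) : ℤ) | d) = J(c | d) := by
  apply jacobiSym.mod_left'
  push_cast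
  simp

lemma jacobiSym_right_add {c d : ℕ} (hd : Odd d) (hcd : Odd (c + d)) :
    J(d | c + d) = (-1) ^ (d / 2 * ((c + d) / 2)) * J(c | d) := by
  rw [jacobiSym.quadratic_reciprocity hd hcd, jacobiSym_add_left']

lemma jacobiSym_left_right_add {c d : ℕ} (hd : Odd d) (hcd : Odd (c + d)) :
    J(c | c + d) = (-1) ^ ((c + d) / 2 + d / 2 * ((c + d) / 2)) * J(c | d) := by
  have h : J(c | c + d) = J(-(d : ℤ) | c + d) := jacobiSym.mod_left' (Int.modEq_iff_dvd.mpr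
    ⟨-1, by push_cast; ring⟩)
  rw [h, jacobiSym.neg _ hcd, ZMod.χ₄_eq_neg_one_pow (Nat.odd_iff.mp hcd),
    jacobiSym_right_add hd hcd, pow_add, mul_assoc]

lemma dvd_24_of_zmod {x : ℤ} (h3 : (x : ZMod 3) = 0) (h8 : (x : ZMod 8) = 0) : (24 : ℤ) ∣ x := by
  rw [ZMod.intCast_zmod_eq_zero_iff_dvd] at h3 h8
  push_cast at h3 h8
  lia

/-- Since -1 = `zeta24 12`, signs from quadratic reciprocity move into the exponent, leaving a
congruence mod 24. -/
lemma sign_mul_zeta24 (j : ℤ) (s : ℕ) {m n : ℤ} (h : (24 : ℤ) ∣ s * 12 + m - n) :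
    (((-1) ^ s * j : ℤ) : ℂ) * zeta24 m = j * zeta24 n := by
  rw [← zeta24_eq_of_dvd h, zeta24_add, ← neg_one_pow_eq_zeta24]
  push_cast
  ring

lemma odd_of_det {a b c d : ℕ} (h : a * d = b * c + 1) (hc : ¬ Odd c) : Odd d := by
  by_contra hd
  rw [Nat.not_odd_iff_even] at hc hd
  have h1 := hd.mul_left a
  rw [h] at h1
  exact Nat.even_add_one.mp h1 (hc.mul_left b)

lemma etaMultiplier_one : etaMultiplier 1 0 0 1 = 1 := by
  simp [etaMultiplier, zeta24_zero]

/-- For odd c the symbol depends only on d mod c; for even c, c ≡ -d mod c+d and reciprocity change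
it by a sign. What remains is a congruence, checked mod 3 and mod 8. -/
lemma etaMultiplier_mul_T {a b c d : ℕ} (h : a * d = b * c + 1) :
    etaMultiplier a (a + b) c (c + d) = etaMultiplier a b c d * zeta24 1 := by
  have h3 : (a * d : ZMod 3) = b * c + 1 := by exact_mod_cast congrArg (Nat.cast : ℕ → ZMod 3) h
  have h8 : (a * d : ZMod 8) = b * c + 1 := by exact_mod_cast congrArg (Nat.cast : ℕ → ZMod 8) h
  unfold etaMultiplier
  by_cases hc : Odd c
  · rw [if_pos hc, if_pos hc, jacobiSym_add_left, mul_assoc _ (zeta24 _) (zeta24 _), ← zeta24_add]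
    congr 1
    apply zeta24_eq_of_dvd
    apply dvd_24_of_zmod
    · push_cast
      generalize (a : ZMod 3) = a, (b : ZMod 3) = b, (c : ZMod 3) = c, (d : ZMod 3) = d at *
      revert a b c d
      decide
    · have hc8 : (c : ZMod 8) ^ 2 = 1 := by
        obtain ⟨u, rfl⟩ := hc
        push_cast
        generalize (u : ZMod 8) = u
        revert u
        decide
      push_cast
      linear_combination (1 - (a * c + a * d + b * c : ZMod 8)) * hc8
  · have hd : Odd d := odd_of_det h hc
    rw [if_neg hc, if_neg hc]
    rw [Nat.not_odd_iff_even] at hc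
    have hcd : Odd (c + d) := hc.add_odd hd
    rw [jacobiSym_left_right_add hd hcd, mul_assoc _ (zeta24 _) (zeta24 _), ← zeta24_add]
    apply sign_mul_zeta24
    apply dvd_24_of_zmod
    · push_cast
      rw [show (12 : ZMod 3) = 0 by decide, mul_zero]
      generalize (a : ZMod 3) = a, (b : ZMod 3) = b, (c : ZMod 3) = c, (d : ZMod 3) = d at *
      revert a b c d
      decide
    · obtain ⟨u, rfl⟩ := hc.two_dvd
      obtain ⟨v, rfl⟩ := hd
      rw [show (2 * u + (2 * v + 1)) / 2 = u + v by lia, show (2 * v + 1) / 2 = v by lia]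
      push_cast at h8 ⊢
      -- As d² ≡ 1 mod 8, the determinant equation can be solved for a; this leaves three free
      -- residues to enumerate.
      have ha : (a : ZMod 8) = (2 * v + 1) * (b * (2 * u) + 1) := by
        rw [← h8]
        have : ((2 * v + 1) * (2 * v + 1) : ZMod 8) = 1 := by
          generalize (v : ZMod 8) = v
          revert v
          decide
        linear_combination -(a : ZMod 8) * this
      rw [ha]
      clear ha h8 h3 h hcd hc
      generalize (b : ZMod 8) = b, (u : ZMod 8) = u, (v : ZMod 8) = v at *
      revert b u v
      decide

/-- The lower left entry changes from c to c+d, so the formula may switch branch; the three possible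
parities of (c, d) are treated separately, each by reciprocity. -/
lemma etaMultiplier_mul_L {a b c d : ℕ} (h : a * d = b * c + 1) :
    etaMultiplier (a + b) b (c + d) d = etaMultiplier a b c d * zeta24 (-1) := by
  have h3 : (a * d : ZMod 3) = b * c + 1 := by exact_mod_cast congrArg (Nat.cast : ℕ → ZMod 3) h
  have h8 : (a * d : ZMod 8) = b * c + 1 := by exact_mod_cast congrArg (Nat.cast : ℕ → ZMod 8) h
  unfold etaMultiplier
  by_cases hc : Odd c
  · by_cases hd : Odd d
    · have hcd : ¬ Odd (c + d) := by
        rw [Nat.not_odd_iff_even]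
        exact hc.add_odd hd
      rw [if_neg hcd, if_pos hc, jacobiSym_add_left', mul_assoc _ (zeta24 _) (zeta24 _), ← zeta24_add,
        jacobiSym.quadratic_reciprocity hc hd]
      apply sign_mul_zeta24
      apply dvd_24_of_zmod
      · push_cast
        rw [show (12 : ZMod 3) = 0 by decide, mul_zero]
        generalize (a : ZMod 3) = a, (b : ZMod 3) = b, (c : ZMod 3) = c, (d : ZMod 3) = d at *
        revert a b c d
        decide
      · obtain ⟨u, rfl⟩ := hc
        obtain ⟨v, rfl⟩ := hd
        rw [show (2 * u + 1) / 2 = u by lia, show (2 * v + 1) / 2 = v by lia]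
        push_cast at h8 ⊢
        have ha : (a : ZMod 8) = (2 * v + 1) * (b * (2 * u + 1) + 1) := by
          rw [← h8]
          have : ((2 * v + 1) * (2 * v + 1) : ZMod 8) = 1 := by
            generalize (v : ZMod 8) = v
            revert v
            decide
          linear_combination -(a : ZMod 8) * this
        rw [ha]
        clear ha h8 h3 h hcd
        generalize (b : ZMod 8) = b, (u : ZMod 8) = u, (v : ZMod 8) = v at *
        revert b u v
        decide
    · rw [Nat.not_odd_iff_even] at hd
      have hcd : Odd (d + c) := hd.add_odd hc
      rw [add_comm c d, if_pos hcd, if_pos hc, jacobiSym_left_right_add hc hcd, mul_assoc _ (zeta24 _) (zeta24 _),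
        ← zeta24_add]
      apply sign_mul_zeta24
      apply dvd_24_of_zmod
      · push_cast
        rw [show (12 : ZMod 3) = 0 by decide, mul_zero]
        generalize (a : ZMod 3) = a, (b : ZMod 3) = b, (c : ZMod 3) = c, (d : ZMod 3) = d at *
        revert a b c d
        decide
      · obtain ⟨u, rfl⟩ := hc
        obtain ⟨v, rfl⟩ := hd.two_dvd
        rw [show (2 * v + (2 * u + 1)) / 2 = u + v by lia, show (2 * u + 1) / 2 = u by lia]
        push_cast at h8 ⊢
        have hb : (b : ZMod 8) = (2 * u + 1) * (a * (2 * v) - 1) := by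
          have : ((2 * u + 1) * (2 * u + 1) : ZMod 8) = 1 := by
            generalize (u : ZMod 8) = u
            revert u
            decide
          linear_combination -(b : ZMod 8) * this - (2 * u + 1 : ZMod 8) * h8
        rw [hb]
        clear hb h8 h3 h hcd hd
        generalize (a : ZMod 8) = a, (u : ZMod 8) = u, (v : ZMod 8) = v at *
        revert a u v
        decide
  · have hd : Odd d := odd_of_det h hc
    rw [if_neg hc]
    rw [Nat.not_odd_iff_even] at hc
    have hcd : Odd (c + d) := hc.add_odd hd
    rw [if_pos hcd, jacobiSym_right_add hd hcd, mul_assoc _ (zeta24 _) (zeta24 _), ← zeta24_add]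
    apply sign_mul_zeta24
    apply dvd_24_of_zmod
    · push_cast
      rw [show (12 : ZMod 3) = 0 by decide, mul_zero]
      generalize (a : ZMod 3) = a, (b : ZMod 3) = b, (c : ZMod 3) = c, (d : ZMod 3) = d at *
      revert a b c d
      decide
    · obtain ⟨u, rfl⟩ := hc.two_dvd
      obtain ⟨v, rfl⟩ := hd
      rw [show (2 * u + (2 * v + 1)) / 2 = u + v by lia, show (2 * v + 1) / 2 = v by lia]
      push_cast at h8 ⊢
      have ha : (a : ZMod 8) = (2 * v + 1) * (b * (2 * u) + 1) := by
        rw [← h8]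
        have : ((2 * v + 1) * (2 * v + 1) : ZMod 8) = 1 := by
          generalize (v : ZMod 8) = v
          revert v
          decide
        linear_combination -(a : ZMod 8) * this
      rw [ha]
      clear ha h8 h3 h hcd hc
      generalize (b : ZMod 8) = b, (u : ZMod 8) = u, (v : ZMod 8) = v at *
      revert b u v
      decide

/-- The multiplicative monoid of matrices of determinant one with entries in `ℕ` is generated by
`(1 1; 0 1)` and `(1 0; 1 1)`. -/
lemma nat_matrix_induction {P : ℕ → ℕ → ℕ → ℕ → Prop} (h1 : P 1 0 0 1)
    (hT : ∀ a b c d, a * d = b * c + 1 → P a b c d → P a (a + b) c (c + d))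
    (hL : ∀ a b c d, a * d = b * c + 1 → P a b c d → P (a + b) b (c + d) d)
    (a b c d : ℕ) (h : a * d = b * c + 1) : P a b c d := by
  induction hs : a + b + c + d using Nat.strong_induction_on generalizing a b c d with
  | _ s ih =>
    have ha : a ≠ 0 := by rintro rfl; simp at h
    have hd : d ≠ 0 := by rintro rfl; simp at h
    -- Euclid's algorithm on columns: the determinant forces one column to dominate the other,
    -- unless b = c = 0.
    rcases le_or_gt a b with hab | hab
    · have hcd : c ≤ d := by
        by_contra! hlt
        nlinarith
      obtain ⟨b, rfl⟩ := Nat.exists_eq_add_of_le hab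
      obtain ⟨d, rfl⟩ := Nat.exists_eq_add_of_le hcd
      have h' : a * d = b * c + 1 := by nlinarith
      exact hT _ _ _ _ h' (ih _ (by lia) a b c d h' rfl)
    · rcases le_or_gt d c with hcd | hcd
      · obtain ⟨a, rfl⟩ := Nat.exists_eq_add_of_le hab.le
        obtain ⟨c, rfl⟩ := Nat.exists_eq_add_of_le hcd
        have h' : a * d = b * c + 1 := by nlinarith
        rw [add_comm b a, add_comm d c]
        exact hL _ _ _ _ h' (ih _ (by lia) a b c d h' rfl)
      · have hb0 : b = 0 := by nlinarith
        have hc0 : c = 0 := by nlinarith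
        subst hb0 hc0
        simp only [zero_mul, zero_add, mul_eq_one] at h
        rw [h.1, h.2]
        exact h1

lemma im_linear_nonneg {z : ℂ} (hz : 0 < z.im) (c d : ℕ) : 0 ≤ ((c : ℂ) * z + d).im := by
  simp
  positivity

lemma linear_ne_zero_of_nat {z : ℂ} (hz : 0 < z.im) {c d : ℕ} (hd : d ≠ 0) :
    (c : ℂ) * z + d ≠ 0 := by
  intro h
  have him := congrArg Complex.im h
  simp at him
  rcases him with rfl | h0
  · simp at h
    exact hd h
  · exact hz.ne' h0

/-- The transformation law of the Dedekind eta function. -/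
theorem eta_moebius {a b c d : ℕ} (h : a * d = b * c + 1) {z : ℂ} (hz : 0 < z.im) :
    ModularForm.eta ((a * z + b) / (c * z + d)) =
      etaMultiplier a b c d * Complex.sqrt (c * z + d) * ModularForm.eta z := by
  revert z
  refine nat_matrix_induction (P := fun a b c d => ∀ {z : ℂ}, 0 < z.im →
    ModularForm.eta ((a * z + b) / (c * z + d)) =
      etaMultiplier a b c d * Complex.sqrt (c * z + d) * ModularForm.eta z) ?_ ?_ ?_ a b c d h
  · intro z hz
    simp [etaMultiplier_one]
  · intro a b c d h ih z hz
    have := @ih (z + 1) (by simpa using hz)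
    rw [eta_add_one, show (c : ℂ) * (z + 1) + d = c * z + ((c + d : ℕ) : ℂ) by push_cast; ring,
      show (a : ℂ) * (z + 1) + b = a * z + ((a + b : ℕ) : ℂ) by push_cast; ring] at this
    rw [this, etaMultiplier_mul_T h]
    ring
  · intro a b c d h ih z hz
    have hd : d ≠ 0 := by rintro rfl; simp at h
    have hz1 := add_one_ne_zero_of_im hz
    have hw := im_div_add_one_pos hz
    have := @ih (z / (z + 1)) hw
    have e1 : ((c : ℂ) * (z / (z + 1)) + d) * (z + 1) = ((c + d : ℕ) : ℂ) * z + d := by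
      push_cast
      field_simp
      ring
    have e2 : ((a : ℂ) * (z / (z + 1)) + b) * (z + 1) = ((a + b : ℕ) : ℂ) * z + b := by
      push_cast
      field_simp
      ring
    rw [eta_div_add_one hz, ← mul_div_mul_right _ _ hz1, e1, e2] at this
    -- Nonnegative entries matter here: both factors lie in the closed upper half plane, so the
    -- principal roots multiply exactly.
    rw [this, etaMultiplier_mul_L h, ← e1, sqrt_mul_of_im (im_linear_nonneg hw c d)
      (by simpa using hz.le)]
    · ring
    · rw [e1]
      have : 0 < c + d := by lia
      simp only [Complex.add_im, Complex.mul_im, Complex.natCast_re, Complex.natCast_im]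
      simp
      positivity

/-! ### The transformation behaviour of eta-quotients -/

/-- The eta-quotient as a function of a complex number. -/
def etaProd (r : ℕ+ →₀ ℤ) (z : ℂ) : ℂ :=
  r.prod fun n e => ModularForm.eta (((n : ℕ) : ℂ) * z) ^ e

lemma etaQuotient_eq (r : ℕ+ →₀ ℤ) (τ : ℍ) : etaQuotient r τ = etaProd r τ := rfl

lemma im_nat_mul_pos {n : ℕ} (hn : 0 < n) {z : ℂ} (hz : 0 < z.im) : 0 < ((n : ℂ) * z).im := by
  simp
  positivity

lemma etaProd_ne_zero (r : ℕ+ →₀ ℤ) {z : ℂ} (hz : 0 < z.im) : etaProd r z ≠ 0 :=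
  Finset.prod_ne_zero_iff.mpr fun n _ =>
    zpow_ne_zero _ (ModularForm.eta_ne_zero (im_nat_mul_pos n.pos hz))

lemma zeta24_sum {ι : Type*} (s : Finset ι) (g : ι → ℤ) :
    zeta24 (∑ i ∈ s, g i) = ∏ i ∈ s, zeta24 (g i) := by
  classical
  induction s using Finset.induction_on with
  | empty => simp [zeta24_zero]
  | insert i s hi ih => rw [Finset.sum_insert hi, Finset.prod_insert hi, zeta24_add, ih]

lemma etaProd_add_int (r : ℕ+ →₀ ℤ) (hx : 24 ∣ xN r) (z : ℂ) (m : ℤ) :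
    etaProd r (z + m) = etaProd r z := by
  have h : zeta24 (m * xN r) = 1 := by
    obtain ⟨t, ht⟩ := hx
    rw [ht, show m * (24 * t) = 24 * (m * t) by ring, zeta24_mul_24]
  rw [← one_mul (etaProd r z), ← h, xN, Finsupp.sum, Finset.mul_sum, zeta24_sum, etaProd, etaProd,
    Finsupp.prod, Finsupp.prod, ← Finset.prod_mul_distrib]
  refine Finset.prod_congr rfl fun n _ => ?_
  have := eta_add_int ((n : ℕ) * z) ((n : ℕ) * m)
  push_cast at this
  rw [mul_add, this, mul_zpow, ← zeta24_mul]
  congr 2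
  ring

lemma dvd_level {r : ℕ+ →₀ ℤ} {n : ℕ+} (hn : n ∈ r.support) : (n : ℕ) ∣ level r :=
  Finset.dvd_lcm hn

lemma level_pos (r : ℕ+ →₀ ℤ) : 0 < level r := by
  apply Nat.pos_of_ne_zero
  rw [level, Ne, Finset.lcm_eq_zero_iff]
  simp

lemma prod_zpow_eq_zpow_sum {ι : Type*} (s : Finset ι) (g : ι → ℤ) {z : ℂ} (hz : z ≠ 0) :
    z ^ (∑ i ∈ s, g i) = ∏ i ∈ s, z ^ g i := by
  classical
  induction s using Finset.induction_on with
  | empty => simp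
  | insert i s hi ih => rw [Finset.sum_insert hi, Finset.prod_insert hi, zpow_add₀ hz, ih]

/-- The transformation law of `f(lτ)` under a matrix with entries in `ℕ`. -/
lemma etaProd_moebius (r : ℕ+ →₀ ℤ) {l a b c d : ℕ} (hl : 0 < l) (h : a * d = b * c + 1)
    (hc : level r * l ∣ c) {z : ℂ} (hz : 0 < z.im) :
    etaProd r (l * ((a * z + b) / (c * z + d))) =
      (r.prod fun n e => etaMultiplier a (n * l * b) (c / (n * l)) d ^ e) *
        Complex.sqrt (c * z + d) ^ twoWeight r * etaProd r (l * z) := by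
  have hd : d ≠ 0 := by rintro rfl; simp at h
  have hs : Complex.sqrt (c * z + d) ≠ 0 := sqrt_ne_zero (linear_ne_zero_of_nat hz hd)
  rw [twoWeight, Finsupp.sum, etaProd, etaProd, Finsupp.prod, Finsupp.prod, Finsupp.prod,
    prod_zpow_eq_zpow_sum _ _ hs, ← Finset.prod_mul_distrib, ← Finset.prod_mul_distrib]
  refine Finset.prod_congr rfl fun n hn => ?_
  obtain ⟨c, rfl⟩ := (mul_dvd_mul_right (dvd_level hn) l).trans hc
  have hnl : 0 < (n : ℕ) * l := Nat.mul_pos n.pos hl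
  rw [Nat.mul_div_cancel_left _ hnl, ← mul_zpow, ← mul_zpow]
  -- Conjugating by diag(nl, 1) carries the action on z to an action on nlz; c now denotes the old
  -- lower left entry divided by nl.
  have h' : a * d = (n * l * b) * c + 1 := by rw [h]; ring
  have := eta_moebius h' (im_nat_mul_pos hnl hz)
  push_cast at this ⊢
  rw [show (n : ℕ) * ((l : ℂ) * z) = (n : ℕ) * l * z by ring,
    show ((n : ℕ) * (l : ℂ) * c * z + d) = c * ((n : ℕ) * l * z) + d by ring, ← this]
  congr 2
  ring

/-- The subgroup of the elements of `SL₂(ℤ)` leaving a function on the upper half plane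
invariant. -/
def invariance (h : ℍ → ℂ) : Subgroup SL(2, ℤ) where
  carrier := {γ | ∀ τ : ℍ, h (γ • τ) = h τ}
  mul_mem' := by
    intro γ δ hγ hδ τ
    rw [mul_smul, hγ, hδ]
  one_mem' := by
    intro τ
    rw [one_smul]
  inv_mem' := by
    intro γ hγ τ
    rw [← hγ, smul_inv_smul]

/-! ### Automorphy of f under Γ₀(N) -/

lemma coe_smul_int (γ : SL(2, ℤ)) (τ : ℍ) :
    ((γ • τ : ℍ) : ℂ) = (((γ 0 0 : ℤ) : ℂ) * τ + ((γ 0 1 : ℤ) : ℂ)) /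
      (((γ 1 0 : ℤ) : ℂ) * τ + ((γ 1 1 : ℤ) : ℂ)) := by
  rw [coe_specialLinearGroup_apply]
  simp

lemma coe_T_zpow_smul (i : ℤ) (τ : ℍ) : ((ModularGroup.T ^ i • τ : ℍ) : ℂ) = τ + i := by
  rw [modular_T_zpow_smul]
  simp [add_comm]

/-- The factor of automorphy `cτ + d`. -/
def autFactor (γ : SL(2, ℤ)) (τ : ℍ) : ℂ :=
  ((γ 1 0 : ℤ) : ℂ) * (τ : ℂ) + ((γ 1 1 : ℤ) : ℂ)

lemma autFactor_ne_zero (γ : SL(2, ℤ)) (τ : ℍ) : autFactor γ τ ≠ 0 :=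
  denom_ne_zero γ τ

lemma autFactor_mul (γ δ : SL(2, ℤ)) (τ : ℍ) :
    autFactor (γ * δ) τ = autFactor γ (δ • τ) * autFactor δ τ := by
  have h := autFactor_ne_zero δ τ
  have e0 : (γ * δ) 1 0 = γ 1 0 * δ 0 0 + γ 1 1 * δ 1 0 := by
    simp [Matrix.mul_apply, Fin.sum_univ_two]
  have e1 : (γ * δ) 1 1 = γ 1 0 * δ 0 1 + γ 1 1 * δ 1 1 := by
    simp [Matrix.mul_apply, Fin.sum_univ_two]
  rw [autFactor, autFactor, coe_smul_int, e0, e1]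
  rw [autFactor] at h ⊢
  push_cast
  field_simp
  ring

lemma det_eq_one (γ : SL(2, ℤ)) : γ 0 0 * γ 1 1 - γ 0 1 * γ 1 0 = 1 := by
  have := γ.det_coe
  rwa [Matrix.det_fin_two] at this

lemma T_zpow_mul_mul_T_zpow (γ : SL(2, ℤ)) (i j : ℤ) :
    (ModularGroup.T ^ i * γ * ModularGroup.T ^ j) 0 0 = γ 0 0 + i * γ 1 0 ∧
    (ModularGroup.T ^ i * γ * ModularGroup.T ^ j) 0 1 =
      (γ 0 1 + i * γ 1 1) + j * (γ 0 0 + i * γ 1 0) ∧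
    (ModularGroup.T ^ i * γ * ModularGroup.T ^ j) 1 0 = γ 1 0 ∧
    (ModularGroup.T ^ i * γ * ModularGroup.T ^ j) 1 1 = γ 1 1 + j * γ 1 0 := by
  refine ⟨?_, ?_, ?_, ?_⟩ <;>
    simp only [Matrix.SpecialLinearGroup.coe_mul, ModularGroup.coe_T_zpow, Matrix.mul_apply,
      Fin.sum_univ_two] <;> simp <;> ring

lemma exists_nat_entries (γ : SL(2, ℤ)) (h : 0 ≤ γ 0 0 ∧ 0 ≤ γ 0 1 ∧ 0 ≤ γ 1 0 ∧ 0 ≤ γ 1 1) :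
    ∃ a b c d : ℕ, γ 0 0 = a ∧ γ 0 1 = b ∧ γ 1 0 = c ∧ γ 1 1 = d ∧ a * d = b * c + 1 := by
  obtain ⟨h0, h1, h2, h3⟩ := h
  obtain ⟨a, ha⟩ := Int.eq_ofNat_of_zero_le h0
  obtain ⟨b, hb⟩ := Int.eq_ofNat_of_zero_le h1
  obtain ⟨c, hc⟩ := Int.eq_ofNat_of_zero_le h2
  obtain ⟨d, hd⟩ := Int.eq_ofNat_of_zero_le h3
  refine ⟨a, b, c, d, ha, hb, hc, hd, ?_⟩
  have := det_eq_one γ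
  rw [ha, hb, hc, hd] at this
  zify
  linarith

/-- Translations add multiples of c > 0 to both diagonal entries; once these are positive, bc = ad -
1 ≥ 0 gives b ≥ 0. -/
lemma exists_nonneg_translate (γ : SL(2, ℤ)) (hc : 0 < γ 1 0) :
    ∃ (i j : ℤ) (a b c d : ℕ), (ModularGroup.T ^ i * γ * ModularGroup.T ^ j) 0 0 = a ∧
      (ModularGroup.T ^ i * γ * ModularGroup.T ^ j) 0 1 = b ∧
      (ModularGroup.T ^ i * γ * ModularGroup.T ^ j) 1 0 = c ∧
      (ModularGroup.T ^ i * γ * ModularGroup.T ^ j) 1 1 = d ∧ a * d = b * c + 1 := by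
  refine ⟨|γ 0 0| + 1, |γ 1 1| + 1, exists_nat_entries _ ?_⟩
  have hdet := det_eq_one (ModularGroup.T ^ (|γ 0 0| + 1) * γ * ModularGroup.T ^ (|γ 1 1| + 1))
  obtain ⟨h0, -, h2, h3⟩ := T_zpow_mul_mul_T_zpow γ (|γ 0 0| + 1) (|γ 1 1| + 1)
  have ha : 0 < (ModularGroup.T ^ (|γ 0 0| + 1) * γ * ModularGroup.T ^ (|γ 1 1| + 1)) 0 0 := by
    rw [h0]
    nlinarith [neg_abs_le (γ 0 0), abs_nonneg (γ 0 0)]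
  have hd : 0 < (ModularGroup.T ^ (|γ 0 0| + 1) * γ * ModularGroup.T ^ (|γ 1 1| + 1)) 1 1 := by
    rw [h3]
    nlinarith [neg_abs_le (γ 1 1), abs_nonneg (γ 1 1)]
  refine ⟨ha.le, ?_, h2 ▸ hc.le, hd.le⟩
  rw [h2] at hdet
  by_contra! hlt
  nlinarith [mul_pos ha hd]

lemma etaQuotient_T_zpow_smul (r : ℕ+ →₀ ℤ) (hx : 24 ∣ xN r) (i : ℤ) (τ : ℍ) :
    etaQuotient r (ModularGroup.T ^ i • τ) = etaQuotient r τ := by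
  rw [etaQuotient_eq, etaQuotient_eq, coe_T_zpow_smul, etaProd_add_int r hx]

lemma mem_Gamma0_iff_dvd {N : ℕ} {γ : SL(2, ℤ)} :
    γ ∈ CongruenceSubgroup.Gamma0 N ↔ (N : ℤ) ∣ γ 1 0 := by
  rw [CongruenceSubgroup.Gamma0_mem, ZMod.intCast_zmod_eq_zero_iff_dvd]

lemma autFactor_neg (γ : SL(2, ℤ)) (τ : ℍ) : autFactor (-γ) τ = -autFactor γ τ := by
  simp [autFactor]
  ring

/-- f is invariant under translations, so γ may be replaced by a translate with nonnegative entries,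
to which the multiplier formula applies. -/
lemma exists_automorphy_of_pos (r : ℕ+ →₀ ℤ) {k : ℤ} (hk : twoWeight r = 2 * k)
    (hx : 24 ∣ xN r) {γ : SL(2, ℤ)} (hγ : γ ∈ CongruenceSubgroup.Gamma0 (level r))
    (hc : 0 < γ 1 0) :
    ∃ v : ℂ, ∀ τ : ℍ, etaQuotient r (γ • τ) = v * autFactor γ τ ^ k * etaQuotient r τ := by
  obtain ⟨i, j, a, b, c, d, h0, h1, h2, h3, h⟩ := exists_nonneg_translate γ hc
  have hN : level r ∣ c := by
    rw [mem_Gamma0_iff_dvd, ← (T_zpow_mul_mul_T_zpow γ i j).2.2.1, h2] at hγ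
    exact_mod_cast hγ
  refine ⟨r.prod fun n e => etaMultiplier a (n * 1 * b) (c / (n * 1)) d ^ e, fun τ => ?_⟩
  have hd : d ≠ 0 := by rintro rfl; simp at h
  set δ := ModularGroup.T ^ i * γ * ModularGroup.T ^ j with hδ
  set σ := ModularGroup.T ^ (-j) • τ with hσ
  have hγσ : ModularGroup.T ^ i • (γ • τ) = δ • σ := by
    rw [hδ, hσ, ← mul_smul, ← mul_smul, mul_assoc _ (ModularGroup.T ^ j), ← zpow_add,
      add_neg_cancel, zpow_zero, mul_one]
  rw [← etaQuotient_T_zpow_smul r hx i, hγσ, etaQuotient_eq, coe_smul_int, h0, h1, h2, h3,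
    ← etaQuotient_T_zpow_smul r hx (-j) τ, ← hσ, etaQuotient_eq]
  have := etaProd_moebius r one_pos h (by simpa using hN) σ.im_pos
  rw [Nat.cast_one, one_mul, one_mul] at this
  push_cast at this ⊢
  have hfac : (c : ℂ) * σ + d = autFactor γ τ := by
    have e3 := (T_zpow_mul_mul_T_zpow γ i j).2.2.2
    have e2 := (T_zpow_mul_mul_T_zpow γ i j).2.2.1
    rw [← hδ, h3] at e3
    rw [← hδ, h2] at e2
    rw [hσ, coe_T_zpow_smul, autFactor, ← Int.cast_natCast d, e3, ← e2]
    push_cast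
    ring
  rw [hfac] at this ⊢
  rw [this, hk, sqrt_zpow_two_mul (autFactor_ne_zero γ τ)]

/-- An eta-quotient of integral weight transforms under `Γ₀(N)` with some character. -/
theorem exists_automorphy (r : ℕ+ →₀ ℤ) {k : ℤ} (hk : twoWeight r = 2 * k)
    (hx : 24 ∣ xN r) {γ : SL(2, ℤ)} (hγ : γ ∈ CongruenceSubgroup.Gamma0 (level r)) :
    ∃ v : ℂ, ∀ τ : ℍ, etaQuotient r (γ • τ) = v * autFactor γ τ ^ k * etaQuotient r τ := by
  rcases lt_trichotomy (γ 1 0) 0 with hc | hc | hc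
  · have hγ' : -γ ∈ CongruenceSubgroup.Gamma0 (level r) := by
      rw [mem_Gamma0_iff_dvd] at hγ ⊢
      simpa using hγ
    obtain ⟨v, hv⟩ := exists_automorphy_of_pos r hk hx hγ' (by simpa using hc)
    refine ⟨v * (-1) ^ k, fun τ => ?_⟩
    rw [← ModularGroup.SL_neg_smul, hv, autFactor_neg, neg_eq_neg_one_mul (autFactor γ τ),
      mul_zpow]
    ring
  · obtain ⟨n, hn⟩ := ModularGroup.exists_eq_T_zpow_of_c_eq_zero hc
    refine ⟨(γ 1 1 : ℂ) ^ (-k), fun τ => ?_⟩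
    have hd : ((γ 1 1 : ℤ) : ℂ) ≠ 0 := by
      have := autFactor_ne_zero γ τ
      simpa [autFactor, hc] using this
    rw [hn τ, etaQuotient_T_zpow_smul r hx, autFactor, hc]
    simp
    field_simp
  · exact exists_automorphy_of_pos r hk hx hγ hc

/-! ### Invariance of f(lτ)/f(τ) -/

/-- The quotient `f(lτ) / f(τ)` of an eta-quotient `f`. -/
def scaleQuotient (r : ℕ+ →₀ ℤ) (l : ℕ) (τ : ℍ) : ℂ := etaProd r (l * τ) / etaProd r τ

/-- f(lτ) and f(τ) have the same factor of automorphy up to their constant multipliers, so equality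
of the latter suffices. -/
lemma mem_invariance_scaleQuotient_of_nat {r : ℕ+ →₀ ℤ} {l a b c d : ℕ} (hl : 0 < l)
    (h : a * d = b * c + 1) (hc : level r * l ∣ c)
    (hE : (r.prod fun n e => etaMultiplier a (n * l * b) (c / (n * l)) d ^ e) =
      r.prod fun n e => etaMultiplier a (n * b) (c / n) d ^ e)
    {γ : SL(2, ℤ)} (h0 : γ 0 0 = a) (h1 : γ 0 1 = b) (h2 : γ 1 0 = c) (h3 : γ 1 1 = d) :
    γ ∈ invariance (scaleQuotient r l) := by
  intro τ
  have e1 := etaProd_moebius r hl h hc τ.im_pos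
  have e2 := etaProd_moebius r one_pos h (by simpa using (dvd_mul_right _ l).trans hc) τ.im_pos
  simp only [Nat.cast_one, one_mul, mul_one] at e2
  rw [hE] at e1
  have hne := etaProd_ne_zero r (γ • τ).im_pos
  have hcoe : ((γ • τ : ℍ) : ℂ) = (a * τ + b) / (c * τ + d) := by
    rw [coe_smul_int, h0, h1, h2, h3]
    push_cast
    rfl
  rw [scaleQuotient, scaleQuotient, div_eq_div_iff hne (etaProd_ne_zero r τ.im_pos)]
  change etaProd r (l * ((γ • τ : ℍ) : ℂ)) * _ = _
  rw [hcoe, e1, e2]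
  ring

/-- The matrix `(1 0; t 1)`. -/
def lowerUnipotent (t : ℤ) : SL(2, ℤ) := ⟨!![1, 0; t, 1], by simp⟩

lemma coe_lowerUnipotent (t : ℤ) :
    (lowerUnipotent t : Matrix (Fin 2) (Fin 2) ℤ) = !![1, 0; t, 1] := rfl

lemma mul_lowerUnipotent (γ : SL(2, ℤ)) (t : ℤ) :
    (γ * lowerUnipotent t) 0 0 = γ 0 0 + γ 0 1 * t ∧ (γ * lowerUnipotent t) 0 1 = γ 0 1 ∧
    (γ * lowerUnipotent t) 1 0 = γ 1 0 + γ 1 1 * t ∧ (γ * lowerUnipotent t) 1 1 = γ 1 1 := by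
  refine ⟨?_, ?_, ?_, ?_⟩ <;>
    simp only [Matrix.SpecialLinearGroup.coe_mul, coe_lowerUnipotent, Matrix.mul_apply,
      Fin.sum_univ_two] <;> simp

lemma etaMultiplier_lowerUnipotent (t : ℕ) : etaMultiplier 1 0 t 1 = zeta24 (-t) := by
  rw [etaMultiplier]
  split_ifs with ht
  · simp
    ring_nf
  · simp

lemma twoWeight_prod (r : ℕ+ →₀ ℤ) {z : ℂ} (hz : z ≠ 0) :
    (r.prod fun _ e => z ^ e) = z ^ twoWeight r :=
  (prod_zpow_eq_zpow_sum _ _ hz).symm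

/-- The multiplier of (1 0; t 1) is `zeta24 (-t)`, and the total exponents for f(lτ) and f(τ) differ
by (l-1)·x₁·j. -/
lemma lowerUnipotent_mem_invariance {r : ℕ+ →₀ ℤ} {l : ℕ} (hl : 0 < l)
    (hx : (24 : ℤ) ∣ ((l : ℤ) - 1) * xOne r) (j : ℕ) :
    lowerUnipotent ((level r * l * j : ℕ) : ℤ) ∈ invariance (scaleQuotient r l) := by
  refine mem_invariance_scaleQuotient_of_nat (a := 1) (b := 0) (c := level r * l * j) (d := 1) hl
    (by simp) (dvd_mul_right _ _) ?_ rfl rfl rfl rfl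
  simp only [mul_zero, etaMultiplier_lowerUnipotent, ← zeta24_mul]
  rw [Finsupp.prod, Finsupp.prod, ← zeta24_sum, ← zeta24_sum]
  apply zeta24_eq_of_dvd
  rw [← Finset.sum_sub_distrib]
  have h : ∑ n ∈ r.support, (r n * -((level r * l * j / (n * l) : ℕ) : ℤ) -
      r n * -((level r * l * j / n : ℕ) : ℤ)) = ((l : ℤ) - 1) * xOne r * j := by
    rw [xOne, Finsupp.sum, Finset.mul_sum, Finset.sum_mul]
    refine Finset.sum_congr rfl fun n hn => ?_
    obtain ⟨m, hm⟩ := dvd_level hn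
    rw [hm, Nat.mul_div_cancel_left _ n.pos,
      show (n : ℕ) * m * l * j = (n * l) * (m * j) by ring,
      Nat.mul_div_cancel_left _ (Nat.mul_pos n.pos hl),
      show (n : ℕ) * l * (m * j) = n * (l * (m * j)) by ring,
      Nat.mul_div_cancel_left _ n.pos]
    push_cast
    ring
  rw [h]
  exact hx.mul_right _

lemma T_zpow_mem_invariance (r : ℕ+ →₀ ℤ) (l : ℕ) (hx : 24 ∣ xN r) (i : ℤ) :
    ModularGroup.T ^ i ∈ invariance (scaleQuotient r l) := by
  intro τ
  rw [scaleQuotient, scaleQuotient, coe_T_zpow_smul, etaProd_add_int r hx, mul_add]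
  have := etaProd_add_int r hx (l * τ) (l * i)
  push_cast at this
  rw [this]

lemma etaMultiplier_of_dvd {a b c d : ℕ} (hb : 24 ∣ b) (hc : 24 ∣ c) :
    etaMultiplier a b c d = (J(c | d) : ℂ) * zeta24 (3 * d - 3) := by
  have hc' : ¬ Odd c := by
    rw [Nat.not_odd_iff_even]
    exact (even_iff_two_dvd.mpr ((by decide : 2 ∣ 24).trans hc))
  rw [etaMultiplier, if_neg hc']
  congr 1
  apply zeta24_eq_of_dvd
  obtain ⟨b, rfl⟩ := hb
  obtain ⟨c, rfl⟩ := hc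
  refine ⟨a * c * (1 - d ^ 2) + d * (b - c), ?_⟩
  push_cast
  ring

/-- Under these divisibilities the multipliers of f(lτ) and f(τ) differ only by (l/d) to the power ∑
rₙ = 2k, which is 1. -/
lemma mem_invariance_of_dvd {r : ℕ+ →₀ ℤ} {k : ℤ} (hk : twoWeight r = 2 * k) {l : ℕ}
    (hl : 0 < l) {γ : SL(2, ℤ)} (hpos : 0 ≤ γ 0 0 ∧ 0 ≤ γ 0 1 ∧ 0 ≤ γ 1 0 ∧ 0 ≤ γ 1 1)
    (hb : 24 ∣ γ 0 1) (hc : ((24 * (level r * l) : ℕ) : ℤ) ∣ γ 1 0) :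
    γ ∈ invariance (scaleQuotient r l) := by
  obtain ⟨a, b, c, d, h0, h1, h2, h3, h⟩ := exists_nat_entries γ hpos
  rw [h1] at hb
  rw [h2] at hc
  replace hb : 24 ∣ b := by exact_mod_cast hb
  replace hc : 24 * (level r * l) ∣ c := by exact_mod_cast hc
  have hcop : Nat.Coprime c d := by
    apply Nat.Coprime.symm
    rw [← Nat.isCoprime_iff_coprime]
    refine ⟨a, -b, ?_⟩
    have : (a * d : ℤ) = b * c + 1 := by exact_mod_cast h
    linarith
  have hld : Nat.Coprime l d :=
    hcop.coprime_dvd_left (((dvd_mul_left l _).trans (dvd_mul_left _ 24)).trans hc)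
  refine mem_invariance_scaleQuotient_of_nat hl h ((dvd_mul_left _ 24).trans hc) ?_ h0 h1 h2 h3
  have hJ : ((J(l | d) : ℤ) : ℂ) ^ 2 = 1 := by
    exact_mod_cast jacobiSym.sq_one (a := (l : ℤ)) (b := d) (by simpa using hld)
  have hJ0 : ((J(l | d) : ℤ) : ℂ) ≠ 0 := by
    intro h0
    rw [h0] at hJ
    norm_num at hJ
  have hprod := twoWeight_prod r hJ0
  rw [hk, zpow_mul, zpow_ofNat, hJ, one_zpow] at hprod
  rw [← mul_one (Finsupp.prod r _), ← hprod, Finsupp.prod, Finsupp.prod, Finsupp.prod,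
    ← Finset.prod_mul_distrib]
  refine Finset.prod_congr rfl fun n hn => ?_
  have hnl : 0 < (n : ℕ) * l := Nat.mul_pos n.pos hl
  obtain ⟨t, ht⟩ := dvd_level hn
  obtain ⟨s, rfl⟩ := hc
  rw [ht, show 24 * ((n : ℕ) * t * l) * s = n * l * (24 * (t * s)) by ring,
    Nat.mul_div_cancel_left _ hnl, mul_assoc (n : ℕ) l (24 * (t * s)),
    Nat.mul_div_cancel_left _ n.pos, etaMultiplier_of_dvd (hb.mul_left _) (dvd_mul_right _ _),
    etaMultiplier_of_dvd (hb.mul_left _) ((dvd_mul_right _ _).mul_left _), ← mul_zpow]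
  congr 1
  push_cast
  rw [jacobiSym.mul_left (l : ℤ)]
  push_cast
  ring

lemma exists_dvd_add_mul {u : ℤ} (hu : IsCoprime u 24) (s : ℤ) (B : ℤ) :
    ∃ j : ℕ, (24 : ℤ) ∣ s + j * u ∧ B ≤ j := by
  obtain ⟨p, q, hpq⟩ := hu
  refine ⟨((-s * p) + 24 * (|s * p| + |B|)).toNat, ?_, ?_⟩
  · rw [Int.toNat_of_nonneg (by nlinarith [le_abs_self (s * p), abs_nonneg (s * p), abs_nonneg B])]
    refine ⟨s * q + (|s * p| + |B|) * u, ?_⟩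
    linear_combination -s * hpq
  · rw [Int.toNat_of_nonneg (by nlinarith [le_abs_self (s * p), abs_nonneg (s * p), abs_nonneg B])]
    nlinarith [le_abs_self (s * p), abs_nonneg (s * p), abs_nonneg B, le_abs_self B]

lemma isCoprime_24_iff {u : ℤ} : IsCoprime u 24 ↔ u % 2 ≠ 0 ∧ u % 3 ≠ 0 := by
  rw [Int.isCoprime_iff_gcd_eq_one, show (24 : ℤ) = 2 ^ 3 * 3 by norm_num,
    ← Int.isCoprime_iff_gcd_eq_one, IsCoprime.mul_right_iff, IsCoprime.pow_right_iff (by norm_num),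
    isCoprime_comm, isCoprime_comm (x := u), Int.prime_two.coprime_iff_not_dvd,
    Int.prime_three.coprime_iff_not_dvd]
  lia

/-- `f(lτ) / f(τ)` is invariant under `Γ₀(Nl)` if `24` divides `∑ n rₙ` and
`(l - 1) ∑ (N / n) rₙ`. -/
theorem Gamma0_le_invariance {r : ℕ+ →₀ ℤ} {k : ℤ} (hk : twoWeight r = 2 * k)
    (hx : 24 ∣ xN r) {l : ℕ} (hl : 0 < l) (hx1 : (24 : ℤ) ∣ ((l : ℤ) - 1) * xOne r) :
    CongruenceSubgroup.Gamma0 (level r * l) ≤ invariance (scaleQuotient r l) := by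
  have hM : 0 < level r * l := Nat.mul_pos (level_pos r) hl
  -- With d prime to 24, a lower unipotent factor makes c divisible by 24Nl, and then a translation
  -- makes b divisible by 24.
  have hcoprime : ∀ γ ∈ CongruenceSubgroup.Gamma0 (level r * l), 0 ≤ γ 1 0 → 0 < γ 1 1 →
      IsCoprime (γ 1 1) 24 → γ ∈ invariance (scaleQuotient r l) := by
    intro γ hγ hc hd hcop
    rw [mem_Gamma0_iff_dvd] at hγ
    obtain ⟨s, hs⟩ := hγ
    obtain ⟨j, hj, hj1⟩ := exists_dvd_add_mul hcop s 1
    set δ := γ * lowerUnipotent ((level r * l * j : ℕ) : ℤ) with hδ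
    obtain ⟨d00, d01, d10, d11⟩ := mul_lowerUnipotent γ ((level r * l * j : ℕ) : ℤ)
    rw [← hδ] at d00 d01 d10 d11
    replace d10 : δ 1 0 = ((level r * l : ℕ) : ℤ) * (s + j * γ 1 1) := by
      rw [d10, hs]
      push_cast
      ring
    have hM' : (0 : ℤ) < ((level r * l : ℕ) : ℤ) := by exact_mod_cast hM
    have hs0 : 0 ≤ s := by
      by_contra! hlt
      nlinarith
    have hc' : 0 < δ 1 0 := by
      rw [d10]
      apply mul_pos hM'
      nlinarith
    obtain ⟨i, hi, hiB⟩ := exists_dvd_add_mul (d11 ▸ hcop) (δ 0 1) (|δ 0 0| + |δ 0 1|)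
    obtain ⟨e00, e01, e10, e11⟩ := T_zpow_mul_mul_T_zpow δ i 0
    rw [← mul_mem_cancel_right (lowerUnipotent_mem_invariance hl hx1 j), ← hδ,
      ← mul_mem_cancel_left (T_zpow_mem_invariance r l hx i),
      ← mul_mem_cancel_right (T_zpow_mem_invariance r l hx 0)]
    apply mem_invariance_of_dvd hk hl
    · rw [e00, e01, e10, e11]
      have := abs_nonneg (δ 0 0)
      have := abs_nonneg (δ 0 1)
      have := neg_abs_le (δ 0 0)
      have := neg_abs_le (δ 0 1)
      rw [d11]
      refine ⟨?_, ?_, hc'.le, by linarith⟩ <;> nlinarith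
    · rw [e01, zero_mul, add_zero]
      exact hi
    · rw [e10, d10]
      obtain ⟨t, ht⟩ := hj
      rw [ht]
      exact ⟨t, by push_cast; ring⟩
  have hneg : ∀ γ, -γ ∈ invariance (scaleQuotient r l) → γ ∈ invariance (scaleQuotient r l) := by
    intro γ hγ τ
    rw [← hγ τ, ModularGroup.SL_neg_smul]
  have hdet : ∀ γ : SL(2, ℤ), IsCoprime (γ 1 0) (γ 1 1) := by
    intro γ
    exact ⟨-γ 0 1, γ 0 0, by linarith [det_eq_one γ]⟩
  have hlower : ∀ γ ∈ CongruenceSubgroup.Gamma0 (level r * l), 0 < γ 1 0 →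
      γ ∈ invariance (scaleQuotient r l) := by
    intro γ hγ hc
    -- c and d share no factor 2 or 3, so each of these primes excludes at most one class of i; some
    -- i ≤ 3 survives.
    obtain ⟨i, hi0, hi⟩ : ∃ i : ℤ, 0 ≤ i ∧ IsCoprime (γ 1 1 + i * γ 1 0) 24 := by
      obtain ⟨p, q, hpq⟩ := hdet γ
      simp only [isCoprime_24_iff]
      have h2 : ¬ (γ 1 0 % 2 = 0 ∧ γ 1 1 % 2 = 0) := by
        rintro ⟨hu, hv⟩
        obtain ⟨u, hu⟩ := Int.dvd_of_emod_eq_zero hu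
        obtain ⟨v, hv⟩ := Int.dvd_of_emod_eq_zero hv
        rw [hu, hv] at hpq
        have : 2 * (p * u + q * v) = 1 := by linarith
        lia
      have h3 : ¬ (γ 1 0 % 3 = 0 ∧ γ 1 1 % 3 = 0) := by
        rintro ⟨hu, hv⟩
        obtain ⟨u, hu⟩ := Int.dvd_of_emod_eq_zero hu
        obtain ⟨v, hv⟩ := Int.dvd_of_emod_eq_zero hv
        rw [hu, hv] at hpq
        have : 3 * (p * u + q * v) = 1 := by linarith
        lia
      generalize γ 1 0 = c at *
      generalize γ 1 1 = d at *
      have key : (d % 2 ≠ 0 ∧ d % 3 ≠ 0) ∨ ((d + 1 * c) % 2 ≠ 0 ∧ (d + 1 * c) % 3 ≠ 0) ∨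
          ((d + 2 * c) % 2 ≠ 0 ∧ (d + 2 * c) % 3 ≠ 0) ∨
          ((d + 3 * c) % 2 ≠ 0 ∧ (d + 3 * c) % 3 ≠ 0) := by
        lia
      rcases key with h | h | h | h
      · exact ⟨0, le_rfl, by simpa using h⟩
      · exact ⟨1, by norm_num, h⟩
      · exact ⟨2, by norm_num, h⟩
      · exact ⟨3, by norm_num, h⟩
    -- The extra multiple of 24 makes the lower right entry positive and keeps it prime to 24.
    obtain ⟨-, -, e10, e11⟩ := T_zpow_mul_mul_T_zpow γ 0 (i + 24 * (|γ 1 1| + 1))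
    rw [← mul_mem_cancel_left (T_zpow_mem_invariance r l hx 0),
      ← mul_mem_cancel_right (T_zpow_mem_invariance r l hx (i + 24 * (|γ 1 1| + 1)))]
    apply hcoprime
    · rw [mem_Gamma0_iff_dvd] at hγ ⊢
      rwa [e10]
    · rw [e10]
      exact hc.le
    · rw [e11]
      have := neg_abs_le (γ 1 1)
      have := abs_nonneg (γ 1 1)
      nlinarith
    · rw [e11, show γ 1 1 + (i + 24 * (|γ 1 1| + 1)) * γ 1 0 =
        γ 1 1 + i * γ 1 0 + 24 * ((|γ 1 1| + 1) * γ 1 0) by ring]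
      exact (IsCoprime.add_mul_left_left_iff).mpr hi
  intro γ hγ
  have hγ' : -γ ∈ CongruenceSubgroup.Gamma0 (level r * l) := by
    rw [mem_Gamma0_iff_dvd] at hγ ⊢
    simpa using hγ
  rcases lt_trichotomy (γ 1 0) 0 with hc | hc | hc
  · exact hneg γ (hlower (-γ) hγ' (by simpa using hc))
  · have hu := det_eq_one γ
    rw [hc, mul_zero, sub_zero] at hu
    rcases Int.eq_one_or_neg_one_of_mul_eq_one hu with h | h
    · rw [h, one_mul] at hu
      exact hcoprime γ hγ hc.ge (by rw [hu]; norm_num) (by rw [hu]; exact isCoprime_one_left)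
    · rw [h] at hu
      have hu' : (-γ) 1 1 = 1 := by
        simp
        linarith
      exact hneg γ (hcoprime (-γ) hγ' (by simp [hc]) (by rw [hu']; norm_num)
        (by rw [hu']; exact isCoprime_one_left))
  · exact hlower γ hγ hc

/-! ### A Hecke operator -/

/-- The map `τ ↦ (aτ + b) / d` of the upper half plane. -/
def affine {a d : ℕ} (ha : 0 < a) (hd : 0 < d) (b : ℤ) (τ : ℍ) : ℍ :=
  ⟨((a : ℂ) * τ + b) / d, by
    have := τ.im_pos
    rw [Complex.div_natCast_im]
    simp
    positivity⟩

lemma coe_affine {a d : ℕ} (ha : 0 < a) (hd : 0 < d) (b : ℤ) (τ : ℍ) :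
    ((affine ha hd b τ : ℍ) : ℂ) = ((a : ℂ) * τ + b) / d := rfl

lemma tendsto_affine {a d : ℕ} (ha : 0 < a) (hd : 0 < d) (b : ℤ) :
    Filter.Tendsto (affine ha hd b) atImInfty atImInfty := by
  rw [atImInfty, Filter.tendsto_comap_iff]
  have h : im ∘ affine ha hd b = fun τ : ℍ => (a / d : ℝ) * τ.im := by
    funext τ
    have : ((affine ha hd b τ : ℍ) : ℂ).im = (a / d : ℝ) * τ.im := by
      rw [coe_affine, Complex.div_natCast_im]
      simp
      ring
    exact this
  rw [h]
  exact Filter.Tendsto.const_mul_atTop (by positivity) Filter.tendsto_comap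

/-- The integral matrix `(α β; lC lD)`, with `γ = (α β; C D)`, is the product of an element of
`SL₂(ℤ)` and a triangular matrix. -/
lemma exists_triangular (γ : SL(2, ℤ)) {l : ℕ} (hl : 0 < l) :
    ∃ (a d : ℕ) (ha : 0 < a) (hd : 0 < d) (b : ℤ) (γ' : SL(2, ℤ)),
      a * d = l ∧ a = Int.gcd (γ 0 0) l ∧ γ' 1 0 = d * γ 1 0 ∧
      ∀ τ : ℍ, ((γ' • affine ha hd b τ : ℍ) : ℂ) = ((γ • τ : ℍ) : ℂ) / l ∧
        autFactor γ' (affine ha hd b τ) = a * autFactor γ τ := by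
  have ha : 0 < Int.gcd (γ 0 0) l := Int.gcd_pos_of_ne_zero_right _ (by exact_mod_cast hl.ne')
  obtain ⟨d, hd⟩ : Int.gcd (γ 0 0) l ∣ l := by exact_mod_cast Int.gcd_dvd_right (γ 0 0) (l : ℤ)
  obtain ⟨α, hα⟩ := Int.gcd_dvd_left (γ 0 0) (l : ℤ)
  obtain ⟨p, q, hpq⟩ : ∃ p q : ℤ, γ 0 0 * p + l * q = Int.gcd (γ 0 0) l :=
    ⟨_, _, (Int.gcd_eq_gcd_ab (γ 0 0) l).symm⟩
  generalize Int.gcd (γ 0 0) l = a at *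
  have hd0 : 0 < d := Nat.pos_of_ne_zero (by rintro rfl; lia)
  have hlz : (l : ℤ) = a * d := by exact_mod_cast hd
  have hdet := det_eq_one γ
  -- The first column (γ 0 0, l·γ 1 0) is a times (α, d·γ 1 0); being primitive, the latter
  -- completes to a matrix of determinant one.
  have hcop : IsCoprime α (d * γ 1 0) := by
    refine IsCoprime.mul_right ⟨p, q, ?_⟩ ⟨a * γ 1 1, -γ 0 1, ?_⟩
    · have : (a : ℤ) ≠ 0 := by exact_mod_cast ha.ne'
      apply mul_left_cancel₀ this
      rw [hα, hlz] at hpq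
      linear_combination hpq
    · rw [hα] at hdet
      linear_combination hdet
  obtain ⟨D, B, hDB⟩ := hcop
  -- b is the top entry of γ'⁻¹ applied to the second column (γ 0 1, l·γ 1 1).
  refine ⟨a, d, ha, hd0, D * γ 0 1 + B * l * γ 1 1, ⟨!![α, -B; d * γ 1 0, D], ?_⟩, hd.symm, rfl,
    rfl, fun τ => ?_⟩
  · rw [Matrix.det_fin_two_of]
    linear_combination hDB
  · set γ' : SL(2, ℤ) := ⟨!![α, -B; d * γ 1 0, D], by
      rw [Matrix.det_fin_two_of]
      linear_combination hDB⟩ with hγ'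
    have e00 : γ' 0 0 = α := rfl
    have e01 : γ' 0 1 = -B := rfl
    have e10 : γ' 1 0 = d * γ 1 0 := rfl
    have e11 : γ' 1 1 = D := rfl
    have hdC : (d : ℂ) ≠ 0 := by exact_mod_cast hd0.ne'
    have haC : (a : ℂ) ≠ 0 := by exact_mod_cast ha.ne'
    have hlC : (l : ℂ) = a * d := by exact_mod_cast hd
    have hαC : ((γ 0 0 : ℤ) : ℂ) = a * α := by exact_mod_cast hα
    have hdetC : (a * α * γ 1 1 - γ 0 1 * γ 1 0 : ℂ) = 1 := by
      rw [hα] at hdet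
      exact_mod_cast hdet
    have hDBC : (D * α + B * (d * γ 1 0) : ℂ) = 1 := by exact_mod_cast hDB
    have haut : autFactor γ' (affine ha hd0 (D * γ 0 1 + B * l * γ 1 1) τ) =
        a * autFactor γ τ := by
      rw [autFactor, autFactor, coe_affine, e10, e11]
      push_cast
      rw [hlC]
      field_simp
      linear_combination (a * γ 1 1 : ℂ) * hDBC - (D : ℂ) * hdetC
    refine ⟨?_, haut⟩
    have h1 := autFactor_ne_zero γ τ
    rw [coe_smul_int, coe_smul_int]
    change _ / autFactor γ' _ = _ / autFactor γ τ / _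
    rw [haut, coe_affine, e00, e01, hαC, hlC]
    field_simp
    push_cast
    rw [hlC]
    linear_combination ((γ 0 1 : ℤ) : ℂ) * hDBC + (B * d : ℂ) * hdetC

/-- The quotient `f(τ / l) / f(τ)` of an eta-quotient `f`. -/
def contractQuotient (r : ℕ+ →₀ ℤ) (l : ℕ) (τ : ℍ) : ℂ := etaProd r (τ / l) / etaProd r τ

/-- This quotient at τ is the inverse of f(lσ)/f(σ) at σ = τ/l, and this scaling conjugates Γ₀(N) ∩
Γ⁰(l) into Γ₀(Nl). -/
lemma mem_invariance_contractQuotient {r : ℕ+ →₀ ℤ} {k : ℤ} (hk : twoWeight r = 2 * k)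
    (hx : 24 ∣ xN r) {l : ℕ} (hl : 0 < l) (hx1 : (24 : ℤ) ∣ ((l : ℤ) - 1) * xOne r)
    {γ : SL(2, ℤ)} (hγ : γ ∈ CongruenceSubgroup.Gamma0 (level r)) (hlγ : (l : ℤ) ∣ γ 0 1) :
    γ ∈ invariance (contractQuotient r l) := by
  intro τ
  obtain ⟨β, hβ⟩ := hlγ
  have hdet := det_eq_one γ
  have hlC : (l : ℂ) ≠ 0 := by exact_mod_cast hl.ne'
  set γ' : SL(2, ℤ) := ⟨!![γ 0 0, β; l * γ 1 0, γ 1 1], by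
    rw [Matrix.det_fin_two_of]
    rw [hβ] at hdet
    linear_combination hdet⟩ with hγ'
  have e00 : γ' 0 0 = γ 0 0 := rfl
  have e01 : γ' 0 1 = β := rfl
  have e10 : γ' 1 0 = l * γ 1 0 := rfl
  have e11 : γ' 1 1 = γ 1 1 := rfl
  have hmem : γ' ∈ CongruenceSubgroup.Gamma0 (level r * l) := by
    rw [mem_Gamma0_iff_dvd] at hγ ⊢
    rw [e10, mul_comm (level r)]
    push_cast
    exact mul_dvd_mul_left _ hγ
  have hcontract : ∀ σ : ℍ,
      contractQuotient r l σ = (scaleQuotient r l (affine one_pos hl 0 σ))⁻¹ := by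
    intro σ
    rw [contractQuotient, scaleQuotient, coe_affine, inv_div]
    simp [mul_div_cancel₀ _ hlC]
  have hcoe : affine one_pos hl 0 (γ • τ) = γ' • affine one_pos hl 0 τ := by
    apply UpperHalfPlane.ext
    have h1 := autFactor_ne_zero γ τ
    rw [coe_smul_int, coe_affine, coe_smul_int, coe_affine, e00, e01, e10, e11, hβ]
    rw [autFactor] at h1
    push_cast
    simp only [one_mul, add_zero]
    rw [show (l : ℂ) * (γ 1 0 : ℤ) * (τ / l) = (γ 1 0 : ℤ) * τ by field_simp]
    field_simp
  rw [hcontract, hcontract, hcoe, Gamma0_le_invariance hk hx hl hx1 hmem]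

/-- In integral weight the even exponent removes both the sign ε and the branch of the root. -/
lemma slash_two_mul (k : ℤ) (γ : SL(2, ℤ)) (ε : ℤˣ) (g : ℍ → ℂ) (τ : ℍ) :
    slash (2 * k) γ ε g τ = autFactor γ τ ^ (-k) * g (γ • τ) := by
  change ((((ε : ℤ) : ℂ)) * autFactor γ τ ^ (1 / 2 : ℂ)) ^ (-(2 * k)) * g (γ • τ) = _
  have hz := autFactor_ne_zero γ τ
  have hε : (((ε : ℤ) : ℂ)) ^ 2 = 1 := by
    rcases Int.units_eq_one_or ε with rfl | rfl <;> simp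
  congr 1
  rw [show -(2 * k) = 2 * (-k) by ring, zpow_mul, zpow_ofNat, mul_pow, hε, one_mul,
    ← Complex.cpow_nat_mul]
  norm_num

/-- The value at `τ` of the translate by a coset of a function on the upper half plane. -/
def cosetValue (h : ℍ → ℂ) (Γ : Subgroup SL(2, ℤ)) (q : Γ ⧸ (invariance h).subgroupOf Γ)
    (τ : ℍ) : ℂ :=
  Quotient.liftOn' q (fun γ : Γ => h ((γ : SL(2, ℤ))⁻¹ • τ)) (by
    intro γ δ hγδ
    rw [QuotientGroup.leftRel_apply, Subgroup.mem_subgroupOf] at hγδ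
    have := hγδ ((δ : SL(2, ℤ))⁻¹ • τ)
    rw [← this, ← mul_smul]
    simp)

lemma cosetValue_mk (h : ℍ → ℂ) (Γ : Subgroup SL(2, ℤ)) (γ : Γ) (τ : ℍ) :
    cosetValue h Γ (γ : Γ ⧸ (invariance h).subgroupOf Γ) τ = h ((γ : SL(2, ℤ))⁻¹ • τ) := rfl

lemma cosetValue_smul (h : ℍ → ℂ) (Γ : Subgroup SL(2, ℤ)) (γ : Γ)
    (q : Γ ⧸ (invariance h).subgroupOf Γ) (τ : ℍ) :
    cosetValue h Γ q ((γ : SL(2, ℤ)) • τ) = cosetValue h Γ (γ⁻¹ • q) τ := by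
  induction q using QuotientGroup.induction_on with
  | H δ =>
    rw [MulAction.Quotient.smul_coe, cosetValue_mk, cosetValue_mk, ← mul_smul]
    simp

/-- The sum of the translates of `h` by the cosets of the subgroup of `Γ` leaving `h` invariant. -/
def traceSum (h : ℍ → ℂ) (Γ : Subgroup SL(2, ℤ))
    [Fintype (Γ ⧸ (invariance h).subgroupOf Γ)] (τ : ℍ) : ℂ :=
  ∑ q : Γ ⧸ (invariance h).subgroupOf Γ, cosetValue h Γ q τ

lemma traceSum_smul (h : ℍ → ℂ) (Γ : Subgroup SL(2, ℤ))
    [Fintype (Γ ⧸ (invariance h).subgroupOf Γ)] {γ : SL(2, ℤ)} (hγ : γ ∈ Γ) (τ : ℍ) :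
    traceSum h Γ (γ • τ) = traceSum h Γ τ := by
  have e := fun q => cosetValue_smul h Γ ⟨γ, hγ⟩ q τ
  simp only at e
  rw [traceSum, traceSum]
  simp only [e]
  exact Equiv.sum_comp (MulAction.toPerm (⟨γ, hγ⟩⁻¹ : Γ)) fun q => cosetValue h Γ q τ

/-- The stabilizer contains Γ(l) ∩ Γ₀(N), which has finite index. -/
lemma finite_cosets_contractQuotient {r : ℕ+ →₀ ℤ} {k : ℤ} (hk : twoWeight r = 2 * k)
    (hx : 24 ∣ xN r) {l : ℕ} (hl : 0 < l) (hx1 : (24 : ℤ) ∣ ((l : ℤ) - 1) * xOne r) :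
    Finite (CongruenceSubgroup.Gamma0 (level r) ⧸
      (invariance (contractQuotient r l)).subgroupOf (CongruenceSubgroup.Gamma0 (level r))) := by
  have : NeZero l := ⟨hl.ne'⟩
  have hle : (CongruenceSubgroup.Gamma l).subgroupOf (CongruenceSubgroup.Gamma0 (level r)) ≤
      (invariance (contractQuotient r l)).subgroupOf (CongruenceSubgroup.Gamma0 (level r)) := by
    intro γ hγ
    rw [Subgroup.mem_subgroupOf] at hγ ⊢
    apply mem_invariance_contractQuotient hk hx hl hx1 γ.2
    rw [CongruenceSubgroup.Gamma_mem] at hγ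
    exact (ZMod.intCast_zmod_eq_zero_iff_dvd _ _).mp hγ.2.1
  have := Subgroup.finiteIndex_of_le hle
  infer_instance

/-! ### Holomorphy and membership in the spaces of forms -/

lemma mdifferentiable_of_differentiableOn {G : ℂ → ℂ}
    (hG : DifferentiableOn ℂ G {z | 0 < z.im}) : MDiff fun τ : ℍ => G τ := by
  rw [UpperHalfPlane.mdifferentiable_iff]
  refine hG.congr fun z hz => ?_
  simp [ofComplex_apply_of_im_pos hz]

lemma differentiableOn_etaProd (r : ℕ+ →₀ ℤ) :
    DifferentiableOn ℂ (etaProd r) {z | 0 < z.im} := by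
  have : etaProd r = ∏ n ∈ r.support, fun z : ℂ => ModularForm.eta (((n : ℕ) : ℂ) * z) ^ r n := by
    funext z
    simp [etaProd, Finsupp.prod]
  rw [this]
  refine DifferentiableOn.finsetProd fun n _ z hz => ?_
  have hz' := im_nat_mul_pos n.pos hz
  refine DifferentiableAt.differentiableWithinAt ?_
  refine DifferentiableAt.zpow ?_ (Or.inl (ModularForm.eta_ne_zero hz'))
  exact (ModularForm.differentiableAt_eta_of_mem_upperHalfPlaneSet hz').comp z (by fun_prop)

lemma mdifferentiable_etaQuotient (r : ℕ+ →₀ ℤ) : MDiff (etaQuotient r) :=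
  mdifferentiable_of_differentiableOn (differentiableOn_etaProd r)

lemma mdifferentiable_contractQuotient (r : ℕ+ →₀ ℤ) {l : ℕ} (hl : 0 < l) :
    MDiff (contractQuotient r l) := by
  apply mdifferentiable_of_differentiableOn (G := fun z => etaProd r (z / l) / etaProd r z)
  refine DifferentiableOn.div ?_ (differentiableOn_etaProd r) fun z hz => etaProd_ne_zero r hz
  refine (differentiableOn_etaProd r).comp (by fun_prop) fun z hz => ?_
  simp only [Set.mem_ofPred_eq, Complex.div_natCast_im] at hz ⊢
  positivity

lemma mdifferentiable_comp_smul {h : ℍ → ℂ} (hh : MDiff h) (γ : SL(2, ℤ)) :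
    MDiff fun τ : ℍ => h (γ • τ) :=
  hh.comp (UpperHalfPlane.mdifferentiable_smul (g := (γ : GL (Fin 2) ℝ)) (by simp))

lemma slash_etaQuotient (r : ℕ+ →₀ ℤ) {k : ℤ} (hk : twoWeight r = 2 * k)
    (hx : 24 ∣ xN r) {γ : SL(2, ℤ)} (hγ : γ ∈ CongruenceSubgroup.Gamma0 (level r)) (ε : ℤˣ) :
    slash (2 * k) γ ε (etaQuotient r) = character r γ ε • etaQuotient r := by
  obtain ⟨v, hv⟩ := exists_automorphy r hk hx hγ
  have h : ∀ τ, slash (2 * k) γ ε (etaQuotient r) τ = v * etaQuotient r τ := by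
    intro τ
    have := autFactor_ne_zero γ τ
    rw [slash_two_mul, hv, zpow_neg]
    field_simp
  funext τ
  have hI : etaQuotient r I ≠ 0 := etaProd_ne_zero r I.im_pos
  rw [h, character, hk, h, mul_div_cancel_right₀ _ hI]
  rfl

lemma etaQuotient_mem_modularForms (r : ℕ+ →₀ ℤ) {k : ℤ} (hk : twoWeight r = 2 * k)
    (hx : 24 ∣ xN r) (hhol : IsHolomorphic r) :
    etaQuotient r ∈ modularForms (level r) (twoWeight r) (character r) := by
  refine ⟨mdifferentiable_etaQuotient r, fun γ hγ ε => ?_, hhol⟩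
  rw [hk]
  exact slash_etaQuotient r hk hx hγ ε

/-- Each translate of `f(τ / l)` by an element of `SL₂(ℤ)` comes from a translate of `f` by an
affine map. -/
lemma exists_slash_term {r : ℕ+ →₀ ℤ} {k : ℤ} (hk : twoWeight r = 2 * k)
    (hx : 24 ∣ xN r) {l : ℕ} (hl : 0 < l) {γ : SL(2, ℤ)}
    (hγ : γ ∈ CongruenceSubgroup.Gamma0 (level r)) (δ : SL(2, ℤ)) :
    ∃ (a d : ℕ) (ha : 0 < a) (hd : 0 < d) (b : ℤ) (γ' : SL(2, ℤ)) (C : ℂ),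
      a * d = l ∧ a = Int.gcd ((γ * δ) 0 0) l ∧ γ' 1 0 = d * (γ * δ) 1 0 ∧
      ∀ τ : ℍ, autFactor δ τ ^ (-k) *
        (etaQuotient r (δ • τ) * contractQuotient r l (γ • δ • τ)) =
        C * slash (2 * k) γ' 1 (etaQuotient r) (affine ha hd b τ) := by
  obtain ⟨v, hv⟩ := exists_automorphy r hk hx hγ
  obtain ⟨a, d, ha, hd, b, γ', had, hgcd, h10, hτ⟩ := exists_triangular (γ * δ) hl
  refine ⟨a, d, ha, hd, b, γ', v⁻¹ * (a : ℂ) ^ k, had, hgcd, h10, fun τ => ?_⟩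
  obtain ⟨h1, h2⟩ := hτ τ
  have hδ := autFactor_ne_zero δ τ
  have hγδ := autFactor_ne_zero γ (δ • τ)
  have hf : etaQuotient r (δ • τ) ≠ 0 := etaProd_ne_zero r (δ • τ).im_pos
  have hf' : etaQuotient r (γ • δ • τ) ≠ 0 := etaProd_ne_zero r (γ • δ • τ).im_pos
  have hne := hf'
  rw [hv] at hne
  have hv0 : v ≠ 0 := by
    rintro rfl
    simp at hne
  have haC : (a : ℂ) ≠ 0 := by exact_mod_cast ha.ne'
  rw [slash_two_mul, h2, etaQuotient_eq r (γ' • _), h1, mul_smul, contractQuotient,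
    ← etaQuotient_eq r (γ • _), hv, autFactor_mul, mul_zpow, mul_zpow, zpow_neg, zpow_neg, zpow_neg]
  field_simp

/-- The Hecke operator `T_l`, applied to an eta-quotient. -/
def hecke (r : ℕ+ →₀ ℤ) (l : ℕ)
    [Fintype (CongruenceSubgroup.Gamma0 (level r) ⧸
      (invariance (contractQuotient r l)).subgroupOf (CongruenceSubgroup.Gamma0 (level r)))]
    (τ : ℍ) : ℂ :=
  etaQuotient r τ * traceSum (contractQuotient r l) (CongruenceSubgroup.Gamma0 (level r)) τ

section membership

variable {r : ℕ+ →₀ ℤ} {k : ℤ} {l : ℕ}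
    [Fintype (CongruenceSubgroup.Gamma0 (level r) ⧸
      (invariance (contractQuotient r l)).subgroupOf (CongruenceSubgroup.Gamma0 (level r)))]

lemma mdifferentiable_hecke (hl : 0 < l) : MDiff (hecke r l) := by
  refine (mdifferentiable_etaQuotient r).mul ?_
  have : traceSum (contractQuotient r l) (CongruenceSubgroup.Gamma0 (level r)) =
      ∑ q, cosetValue (contractQuotient r l) (CongruenceSubgroup.Gamma0 (level r)) q := by
    funext τ
    simp [traceSum]
  rw [this]
  refine MDifferentiable.sum fun q _ => ?_
  induction q using QuotientGroup.induction_on with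
  | H γ => exact mdifferentiable_comp_smul (mdifferentiable_contractQuotient r hl) _

/-- W stands for the functions bounded, or vanishing, at i∞, so one argument serves both modular and
cusp forms. -/
lemma slash_hecke_mem (hk : twoWeight r = 2 * k) (hx : 24 ∣ xN r) (hl : 0 < l)
    (W : Submodule ℂ (ℍ → ℂ))
    (hW : ∀ (a d : ℕ) (ha : 0 < a) (hd : 0 < d) (b : ℤ) (γ : SL(2, ℤ)),
      (fun τ => slash (2 * k) γ 1 (etaQuotient r) (affine ha hd b τ)) ∈ W)
    (δ : SL(2, ℤ)) (ε : ℤˣ) : slash (2 * k) δ ε (hecke r l) ∈ W := by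
  have : slash (2 * k) δ ε (hecke r l) =
      ∑ q, fun τ => autFactor δ τ ^ (-k) * (etaQuotient r (δ • τ) *
        cosetValue (contractQuotient r l) (CongruenceSubgroup.Gamma0 (level r)) q (δ • τ)) := by
    funext τ
    rw [slash_two_mul, hecke, traceSum, Finset.mul_sum, Finset.mul_sum, Finset.sum_apply]
  rw [this]
  refine W.sum_mem fun q _ => ?_
  induction q using QuotientGroup.induction_on with
  | H γ =>
    obtain ⟨a, d, ha, hd, b, γ', C, -, -, -, h⟩ := exists_slash_term hk hx hl (inv_mem γ.2) δ
    have := W.smul_mem C (hW a d ha hd b γ')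
    convert this using 1
    funext τ
    exact h τ

lemma hecke_mem_modularForms (hk : twoWeight r = 2 * k) (hx : 24 ∣ xN r) (hl : 0 < l)
    (hhol : IsHolomorphic r) :
    hecke r l ∈ modularForms (level r) (twoWeight r) (character r) := by
  rw [hk]
  refine ⟨mdifferentiable_hecke hl, fun γ hγ ε => ?_, fun δ ε => ?_⟩
  · funext τ
    have := congrFun (slash_etaQuotient r hk hx hγ ε) τ
    rw [slash_two_mul, Pi.smul_apply, smul_eq_mul] at this
    rw [slash_two_mul, hecke, traceSum_smul _ _ hγ, ← mul_assoc, this, Pi.smul_apply, smul_eq_mul,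
      hecke, mul_assoc]
  · refine slash_hecke_mem hk hx hl
      (Subalgebra.toSubmodule (boundedAtImInftySubalgebra ℂ)) (fun a d ha hd b γ => ?_) δ ε
    have := hhol γ 1
    rw [hk] at this
    exact Asymptotics.IsBigO.comp_tendsto this (tendsto_affine ha hd b)

lemma hecke_mem_cuspForms (hk : twoWeight r = 2 * k) (hx : 24 ∣ xN r) (hl : 0 < l)
    (hhol : IsHolomorphic r)
    (hf : etaQuotient r ∈ cuspForms (level r) (twoWeight r) (character r)) :
    hecke r l ∈ cuspForms (level r) (twoWeight r) (character r) := by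
  refine ⟨hecke_mem_modularForms hk hx hl hhol, ?_⟩
  rw [hk]
  refine slash_hecke_mem hk hx hl (zeroAtImInftySubmodule ℂ) (fun a d ha hd b γ => ?_)
  have := hf.2 γ 1
  rw [hk] at this
  exact Filter.Tendsto.comp this (tendsto_affine ha hd b)

/-- A weakly admissible eta-quotient is an eigenform. -/
theorem exists_hecke_eq_smul (hk : twoWeight r = 2 * k) (hx : 24 ∣ xN r) (hl : 0 < l)
    (hadm : IsWeaklyAdmissible r) : ∃ c : ℂ, hecke r l = c • etaQuotient r := by
  have hne : etaQuotient r ≠ 0 := by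
    intro h
    exact etaProd_ne_zero r I.im_pos (congrFun h I)
  have key : ∀ W : Submodule ℂ (ℍ → ℂ), Module.rank ℂ W = 1 → etaQuotient r ∈ W →
      hecke r l ∈ W → ∃ c : ℂ, hecke r l = c • etaQuotient r := by
    intro W hW h1 h2
    have hfin : Module.finrank ℂ W = 1 := Module.rank_eq_one_iff_finrank_eq_one.mp hW
    have hne' : (⟨etaQuotient r, h1⟩ : W) ≠ 0 := fun h => hne (congrArg Subtype.val h)
    obtain ⟨c, hc⟩ := (finrank_eq_one_iff_of_nonzero' _ hne').mp hfin ⟨hecke r l, h2⟩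
    exact ⟨c, (congrArg Subtype.val hc).symm⟩
  obtain ⟨hhol, h | ⟨-, h, hf⟩⟩ := hadm
  · exact key _ h (etaQuotient_mem_modularForms r hk hx hhol)
      (hecke_mem_modularForms hk hx hl hhol)
  · exact key _ h hf (hecke_mem_cuspForms hk hx hl hhol hf)

end membership

/-! ### Fourier expansions -/

/-- The function `g` on the upper half plane has the expansion `∑ c(m) exp(2πi m τ / l)`. -/
def HasExpansion (l : ℕ) (g : ℍ → ℂ) (c : ℕ → ℂ) : Prop :=
  ∀ τ : ℍ, HasSum (fun m => c m • Function.Periodic.qParam l τ ^ m) (g τ)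

lemma HasExpansion.const_mul {l : ℕ} {g : ℍ → ℂ} {c : ℕ → ℂ} (h : HasExpansion l g c) (a : ℂ) :
    HasExpansion l (fun τ => a * g τ) (fun m => a * c m) := by
  intro τ
  simpa [mul_assoc] using (h τ).mul_left a

lemma HasExpansion.sum {l : ℕ} {ι : Type*} {s : Finset ι} {g : ι → ℍ → ℂ} {c : ι → ℕ → ℂ}
    (h : ∀ i ∈ s, HasExpansion l (g i) (c i)) :
    HasExpansion l (fun τ => ∑ i ∈ s, g i τ) (fun m => ∑ i ∈ s, c i m) := by
  intro τ
  simpa [Finset.sum_mul] using hasSum_sum fun i hi => h i hi τ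

/-- The c(m) are Taylor coefficients at 0 of the cusp function of the zero form, hence unique. -/
lemma eq_zero_of_hasExpansion_zero {l : ℕ} (hl : 0 < l) {c : ℕ → ℂ}
    (h : HasExpansion l 0 c) (m : ℕ) : c m = 0 := by
  have hl' : (0 : ℝ) < l := by exact_mod_cast hl
  have han : AnalyticAt ℂ (cuspFunction (l : ℝ) (0 : ℍ → ℂ)) 0 := by
    refine analyticAt_cuspFunction_zero hl' ?_ mdifferentiable_const zero_form_isBoundedAtImInfty
    intro z
    simp
  have h1 := (hasFPowerSeriesOnBall_cuspFunction hl' han h).hasFPowerSeriesAt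
  have h2 := (hasFPowerSeriesOnBall_cuspFunction (c := fun _ => 0) hl' han
    fun τ => by simp).hasFPowerSeriesAt
  simpa [FormalMultilinearSeries.coeff_ofScalars] using
    congrArg (FormalMultilinearSeries.coeff · m) (h1.eq_formalMultilinearSeries h2)

lemma HasExpansion.unique {l : ℕ} (hl : 0 < l) {g : ℍ → ℂ} {c c' : ℕ → ℂ}
    (h : HasExpansion l g c) (h' : HasExpansion l g c') (m : ℕ) : c m = c' m := by
  refine sub_eq_zero.mp (eq_zero_of_hasExpansion_zero hl (c := fun m => c m - c' m) ?_ m)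
  intro τ
  simpa [sub_mul] using (h τ).sub (h' τ)

lemma HasExpansion.comp {l : ℕ} {f : ℍ → ℂ} {c : ℕ → ℂ} (hf : HasExpansion 1 f c) {s : ℕ}
    (hs : 0 < s) (u : ℂ) (w : ℍ → ℍ)
    (hw : ∀ τ : ℍ, Function.Periodic.qParam (1 : ℕ) (w τ) = u * Function.Periodic.qParam l τ ^ s) :
    HasExpansion l (fun τ => f (w τ)) (fun j => if s ∣ j then c (j / s) * u ^ (j / s) else 0) := by
  intro τ
  have hinj : Function.Injective fun m : ℕ => s * m :=
    fun m n h => Nat.eq_of_mul_eq_mul_left hs h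
  rw [← hinj.hasSum_iff]
  · convert hf (w τ) using 1
    funext m
    simp only [Function.comp_apply, dvd_mul_right, if_true, Nat.mul_div_cancel_left _ hs,
      smul_eq_mul]
    rw [hw, mul_pow, ← pow_mul, mul_assoc]
  · intro j hj
    dsimp only
    rw [if_neg, zero_smul]
    rintro ⟨m, rfl⟩
    exact hj ⟨m, rfl⟩

/-- The exponent is a² because a/d = a²/l when ad = l. -/
lemma qParam_affine {a d l : ℕ} (ha : 0 < a) (hd : 0 < d) (b : ℤ) (h : a * d = l) (τ : ℍ) :
    Function.Periodic.qParam (1 : ℕ) (affine ha hd b τ) =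
      Complex.exp (2 * Real.pi * Complex.I * b / d) * Function.Periodic.qParam l τ ^ (a ^ 2) := by
  have haC : (a : ℂ) ≠ 0 := by exact_mod_cast ha.ne'
  have hdC : (d : ℂ) ≠ 0 := by exact_mod_cast hd.ne'
  rw [Function.Periodic.qParam, Function.Periodic.qParam, ← Complex.exp_nat_mul, ← Complex.exp_add,
    coe_affine, ← h]
  congr 1
  push_cast
  field_simp
  ring

lemma etaQuotient_periodic {r : ℕ+ →₀ ℤ} (hx : 24 ∣ xN r) :
    Function.Periodic (etaQuotient r ∘ ofComplex) (1 : ℝ) := by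
  intro z
  by_cases hz : 0 < z.im
  · have hz' : 0 < (z + (1 : ℝ)).im := by simpa using hz
    have := etaProd_add_int r hx z 1
    simp only [Function.comp_apply, ofComplex_apply_of_im_pos hz, ofComplex_apply_of_im_pos hz',
      etaQuotient_eq]
    simpa using this
  · have hz' : ¬ 0 < (z + (1 : ℝ)).im := by simpa using hz
    rw [Function.comp_apply, Function.comp_apply, ofComplex_apply_of_im_nonpos (not_lt.mp hz),
      ofComplex_apply_of_im_nonpos (not_lt.mp hz')]

lemma isBoundedAtImInfty_etaQuotient {r : ℕ+ →₀ ℤ} {k : ℤ} (hk : twoWeight r = 2 * k)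
    (hhol : IsHolomorphic r) : IsBoundedAtImInfty (etaQuotient r) := by
  have h := hhol 1 1
  have he : slash (twoWeight r) 1 1 (etaQuotient r) = etaQuotient r := by
    funext τ
    rw [hk, slash_two_mul]
    simp [autFactor]
  rwa [he] at h

lemma hasExpansion_etaQuotient {r : ℕ+ →₀ ℤ} {k : ℤ} (hk : twoWeight r = 2 * k)
    (hx : 24 ∣ xN r) (hhol : IsHolomorphic r) :
    HasExpansion 1 (etaQuotient r) (fourierCoeff r) := by
  intro τ
  have := hasSum_qExpansion one_pos (etaQuotient_periodic hx) (mdifferentiable_etaQuotient r)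
    (isBoundedAtImInfty_etaQuotient hk hhol) τ
  simpa [fourierCoeff] using this

lemma tendsto_tprod_one_sub_eta_q {n : ℕ} (hn : 0 < n) :
    Filter.Tendsto (fun τ : ℍ => ∏' m, (1 - ModularForm.eta_q m (n * τ))) atImInfty (nhds 1) := by
  have h1 : Filter.Tendsto (fun q : ℂ => ∏' m : ℕ, (1 - q ^ (m + 1))) (nhds 0) (nhds 1) := by
    have hd := (ModularForm.differentiableOn_tprod_one_sub_pow.differentiableAt
      (Metric.isOpen_ball.mem_nhds (Metric.mem_ball_self one_pos))).continuousAt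
    have := hd.tendsto
    simpa using this
  have h2 := (qParam_tendsto_atImInfty one_pos).comp (tendsto_affine hn one_pos 0)
  refine (h1.comp h2).congr fun τ => ?_
  simp [coe_affine, ModularForm.eta_q]

lemma qParam_24_mul (r : ℕ+ →₀ ℤ) {x : ℕ} (hx : xN r = 24 * (x : ℤ)) (z : ℂ) :
    (r.prod fun n e => Function.Periodic.qParam 24 ((n : ℕ) * z) ^ e) =
      Function.Periodic.qParam (1 : ℕ) z ^ x := by
  have hq := Function.Periodic.qParam_ne_zero (h := 24) z
  have h1 : ∀ n : ℕ+, Function.Periodic.qParam 24 ((n : ℕ) * z) =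
      Function.Periodic.qParam 24 z ^ ((n : ℕ) : ℤ) := by
    intro n
    rw [Function.Periodic.qParam, Function.Periodic.qParam, zpow_natCast, ← Complex.exp_nat_mul]
    congr 1
    ring
  simp only [h1, ← zpow_mul]
  rw [Finsupp.prod, ← prod_zpow_eq_zpow_sum _ _ hq]
  change _ ^ xN r = _
  rw [hx, Function.Periodic.qParam, Function.Periodic.qParam, ← Complex.exp_int_mul,
    ← Complex.exp_nat_mul]
  congr 1
  push_cast
  ring

/-- The expansion of an eta-quotient starts with `q ^ x`. -/
lemma fourierCoeff_leading {r : ℕ+ →₀ ℤ} {k : ℤ} (hk : twoWeight r = 2 * k)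
    {x : ℕ} (hx : xN r = 24 * (x : ℤ)) (hhol : IsHolomorphic r) : fourierCoeff r x = 1 := by
  have hx24 : (24 : ℤ) ∣ xN r := ⟨x, hx⟩
  -- Dividing by q^x leaves a product of Euler products tending to 1 at i∞; its constant term
  -- becomes the coefficient of f at x.
  let G : ℂ → ℂ := fun z => etaProd r z / Function.Periodic.qParam (1 : ℕ) z ^ x
  let g : ℍ → ℂ := fun τ => G τ
  have hg : ∀ z, G z = r.prod fun n e => (∏' m, (1 - ModularForm.eta_q m ((n : ℕ) * z))) ^ e := by
    intro z
    have hq := pow_ne_zero x (Function.Periodic.qParam_ne_zero (h := (1 : ℕ)) z)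
    simp only [G]
    rw [div_eq_iff hq, ← qParam_24_mul r hx, etaProd, Finsupp.prod, Finsupp.prod, Finsupp.prod,
      ← Finset.prod_mul_distrib]
    refine Finset.prod_congr rfl fun n _ => ?_
    rw [ModularForm.eta, mul_zpow, mul_comm]
  have hlim : Filter.Tendsto g atImInfty (nhds 1) := by
    have h1 : g = fun τ : ℍ => ∏ n ∈ r.support,
        (∏' m, (1 - ModularForm.eta_q m ((n : ℕ) * τ))) ^ r n := by
      funext τ
      exact hg τ
    rw [h1]
    have h2 := tendsto_finsetProd r.support fun n _ =>
      (tendsto_tprod_one_sub_eta_q n.pos).zpow₀ (r n) (Or.inl one_ne_zero)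
    simpa only [one_zpow, Finset.prod_const_one] using h2
  have hdiff : MDiff g := by
    apply mdifferentiable_of_differentiableOn
    refine (differentiableOn_etaProd r).div ?_ fun z _ =>
      pow_ne_zero x (Function.Periodic.qParam_ne_zero z)
    exact (Function.Periodic.differentiable_qParam.pow x).differentiableOn
  have hper1 : ∀ z, G (z + 1) = G z := by
    intro z
    have h1 := etaProd_add_int r hx24 z 1
    have h2 : Function.Periodic.qParam (1 : ℕ) (z + 1) = Function.Periodic.qParam (1 : ℕ) z := by
      have := (Complex.exp_periodic) (2 * Real.pi * Complex.I * z)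
      simp only [Function.Periodic.qParam, Nat.cast_one, Complex.ofReal_one, div_one, mul_add,
        mul_one] at this ⊢
      exact this
    push_cast at h1
    simp only [G, h1, h2]
  have hper : Function.Periodic (g ∘ ofComplex) (1 : ℝ) := by
    intro z
    by_cases hz : 0 < z.im
    · have hz' : 0 < (z + (1 : ℝ)).im := by simpa using hz
      simp only [Function.comp_apply, ofComplex_apply_of_im_pos hz, ofComplex_apply_of_im_pos hz',
        g]
      simpa using hper1 z
    · have hz' : ¬ 0 < (z + (1 : ℝ)).im := by simpa using hz
      rw [Function.comp_apply, Function.comp_apply, ofComplex_apply_of_im_nonpos (not_lt.mp hz),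
        ofComplex_apply_of_im_nonpos (not_lt.mp hz')]
  have hbdd : IsBoundedAtImInfty g := hlim.isBigO_one ℝ
  have hexp : HasExpansion 1 (etaQuotient r)
      (fun j => if x ≤ j then (qExpansion 1 g).coeff (j - x) else 0) := by
    intro τ
    have hinj : Function.Injective fun m : ℕ => m + x := add_left_injective x
    rw [← hinj.hasSum_iff]
    · have h1 := (hasSum_qExpansion one_pos hper hdiff hbdd τ).mul_left
        (Function.Periodic.qParam (1 : ℕ) τ ^ x)
      have hq := pow_ne_zero x (Function.Periodic.qParam_ne_zero (h := (1 : ℕ)) τ)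
      have e1 : etaQuotient r τ = Function.Periodic.qParam (1 : ℕ) τ ^ x * g τ :=
        (mul_div_cancel₀ _ hq).symm
      rw [e1]
      refine h1.congr_fun fun m => ?_
      simp only [Function.comp_apply, le_add_iff_nonneg_left, zero_le, if_true, Nat.add_sub_cancel,
        smul_eq_mul, pow_add, Nat.cast_one]
      ring
    · intro j hj
      dsimp only
      rw [if_neg, zero_smul]
      intro hle
      exact hj ⟨j - x, Nat.sub_add_cancel hle⟩
  rw [(hasExpansion_etaQuotient hk hx24 hhol).unique one_pos hexp x, if_pos le_rfl, Nat.sub_self,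
    qExpansion_coeff_zero one_pos (analyticAt_cuspFunction_zero one_pos hper hdiff hbdd) hper]
  exact hlim.limUnder_eq

/-! ### Contributions of the cosets -/

section coefficients

variable {r : ℕ+ →₀ ℤ} {k : ℤ} {l : ℕ}

/-- With b = pβ, p inverse to the upper left entry mod l and β the upper right entry, γT^(-b) leaves
h invariant. The term becomes f((τ+b)/l), and its root of unity is trivial at exponents ln. -/
lemma exists_expansion_of_isCoprime (hk : twoWeight r = 2 * k) (hx : 24 ∣ xN r)
    (hhol : IsHolomorphic r) (hl : 0 < l) (hx1 : (24 : ℤ) ∣ ((l : ℤ) - 1) * xOne r)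
    {γ : SL(2, ℤ)} (hγ : γ ∈ CongruenceSubgroup.Gamma0 (level r))
    (hcop : IsCoprime (γ 0 0) (l : ℤ)) :
    ∃ e : ℕ → ℂ, HasExpansion l (fun τ => etaQuotient r τ * contractQuotient r l (γ • τ)) e ∧
      ∀ n, e (l * n) = fourierCoeff r (l * n) := by
  obtain ⟨p, q, hpq⟩ := hcop
  set b : ℤ := p * γ 0 1 with hb
  obtain ⟨-, h01, h10, -⟩ := T_zpow_mul_mul_T_zpow γ 0 (-b)
  have hmem : ModularGroup.T ^ (0 : ℤ) * γ * ModularGroup.T ^ (-b) ∈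
      invariance (contractQuotient r l) := by
    apply mem_invariance_contractQuotient hk hx hl hx1
    · rw [mem_Gamma0_iff_dvd] at hγ ⊢
      rwa [h10]
    · rw [h01]
      exact ⟨q * γ 0 1, by linear_combination (-γ 0 1) * hpq⟩
  have hterm : ∀ τ : ℍ, etaQuotient r τ * contractQuotient r l (γ • τ) =
      etaQuotient r (affine one_pos hl b τ) := by
    intro τ
    have h1 := hmem (ModularGroup.T ^ b • τ)
    rw [← mul_smul, zpow_zero, one_mul, mul_assoc, ← zpow_add, neg_add_cancel, zpow_zero,
      mul_one] at h1
    have hne : etaProd r (ModularGroup.T ^ b • τ : ℍ) ≠ 0 :=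
      etaProd_ne_zero r (ModularGroup.T ^ b • τ).im_pos
    rw [h1, contractQuotient, ← etaQuotient_T_zpow_smul r hx b τ, etaQuotient_eq,
      mul_div_cancel₀ _ hne, etaQuotient_eq, coe_affine, coe_T_zpow_smul, Nat.cast_one, one_mul]
  have hexp := (hasExpansion_etaQuotient hk hx hhol).comp (l := l) (pow_pos one_pos 2)
    (Complex.exp (2 * Real.pi * Complex.I * b / l)) (affine one_pos hl b)
    (qParam_affine one_pos hl b (one_mul l))
  rw [funext hterm]
  refine ⟨_, hexp, fun n => ?_⟩
  have hu : Complex.exp (2 * Real.pi * Complex.I * b / l) ^ l = 1 := by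
    have hlC : (l : ℂ) ≠ 0 := by exact_mod_cast hl.ne'
    rw [← Complex.exp_nat_mul, Complex.exp_eq_one_iff]
    exact ⟨b, by field_simp⟩
  simp [pow_mul, hu]

/-- The term is a multiple of f((aτ+b)/d) with a = gcd(γ 0 0, l) > 1, so its exponents are divisible
by a². If a² ∣ ln with n prime to l, then a² ∣ l; but a prime p ∣ a cannot divide N, by the
determinant. -/
lemma exists_expansion_of_not_isCoprime (hk : twoWeight r = 2 * k) (hx : 24 ∣ xN r)
    (hhol : IsHolomorphic r) (hl : 0 < l)
    (hsq : ∀ p : ℕ, p.Prime → ¬ p ∣ level r → ¬ p ^ 2 ∣ l)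
    {γ : SL(2, ℤ)} (hγ : γ ∈ CongruenceSubgroup.Gamma0 (level r))
    (hcop : ¬ IsCoprime (γ 0 0) (l : ℤ)) :
    ∃ e : ℕ → ℂ, HasExpansion l (fun τ => etaQuotient r τ * contractQuotient r l (γ • τ)) e ∧
      ∀ n, Nat.Coprime l n → e (l * n) = 0 := by
  obtain ⟨a, d, ha, hd, b, γ', C, had, hgcd, h10, hterm⟩ := exists_slash_term hk hx hl hγ 1
  rw [mul_one] at hgcd h10
  have hγ' : γ' ∈ CongruenceSubgroup.Gamma0 (level r) := by
    rw [mem_Gamma0_iff_dvd] at hγ ⊢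
    rw [h10]
    exact hγ.mul_left _
  have hterm' : ∀ τ : ℍ, etaQuotient r τ * contractQuotient r l (γ • τ) =
      C * character r γ' 1 * etaQuotient r (affine ha hd b τ) := by
    intro τ
    have := hterm τ
    rw [slash_etaQuotient r hk hx hγ'] at this
    simpa [autFactor, mul_assoc] using this
  have hexp := ((hasExpansion_etaQuotient hk hx hhol).comp (l := l) (pow_pos ha 2)
    (Complex.exp (2 * Real.pi * Complex.I * b / d)) (affine ha hd b)
    (qParam_affine ha hd b had)).const_mul (C * character r γ' 1)
  rw [funext hterm']
  refine ⟨_, hexp, fun n hn => ?_⟩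
  rw [if_neg, mul_zero]
  intro hdvd
  have hal : a ∣ l := ⟨d, had.symm⟩
  have h1 : a ^ 2 ∣ l :=
    ((hn.coprime_dvd_left hal).pow_left 2).dvd_of_dvd_mul_right hdvd
  have ha1 : a ≠ 1 := by
    intro h
    apply hcop
    rw [Int.isCoprime_iff_gcd_eq_one, ← hgcd, h]
  obtain ⟨p, hp, hpa⟩ := Nat.exists_prime_and_dvd ha1
  refine hsq p hp (fun hpN => ?_) ((pow_dvd_pow_of_dvd hpa 2).trans h1)
  rw [mem_Gamma0_iff_dvd] at hγ
  have h2 : (p : ℤ) ∣ γ 1 0 := (Int.natCast_dvd_natCast.mpr hpN).trans hγ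
  have h3 : (p : ℤ) ∣ γ 0 0 := by
    refine (Int.natCast_dvd_natCast.mpr hpa).trans ?_
    rw [hgcd]
    exact Int.gcd_dvd_left _ _
  have h4 : (p : ℤ) ∣ 1 := by
    rw [← det_eq_one γ]
    exact (h3.mul_right _).sub (h2.mul_left _)
  exact hp.one_lt.ne' (by exact_mod_cast Int.eq_one_of_dvd_one (by positivity) h4)

/-- The Hecke relation between Fourier coefficients. -/
theorem exists_fourierCoeff_relation (hk : twoWeight r = 2 * k) (hx : 24 ∣ xN r)
    (hadm : IsWeaklyAdmissible r) (hl : 0 < l) (hx1 : (24 : ℤ) ∣ ((l : ℤ) - 1) * xOne r)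
    (hsq : ∀ p : ℕ, p.Prime → ¬ p ∣ level r → ¬ p ^ 2 ∣ l) :
    ∃ c K : ℂ, K ≠ 0 ∧
      ∀ n, Nat.Coprime l n → c * fourierCoeff r n = K * fourierCoeff r (l * n) := by
  classical
  have hfin := finite_cosets_contractQuotient hk hx hl hx1
  let := Fintype.ofFinite (CongruenceSubgroup.Gamma0 (level r) ⧸
      (invariance (contractQuotient r l)).subgroupOf (CongruenceSubgroup.Gamma0 (level r)))
  obtain ⟨c, hc⟩ := exists_hecke_eq_smul hk hx hl hadm
  have hhol := hadm.1
  obtain ⟨q₀, hq₀⟩ : ∃ q₀ : CongruenceSubgroup.Gamma0 (level r) ⧸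
      (invariance (contractQuotient r l)).subgroupOf (CongruenceSubgroup.Gamma0 (level r)),
      -- The trivial coset is singled out because its contribution 1 ensures K ≠ 0.
      q₀ = QuotientGroup.mk 1 := ⟨_, rfl⟩
  have hcoset : ∀ q : CongruenceSubgroup.Gamma0 (level r) ⧸
      (invariance (contractQuotient r l)).subgroupOf (CongruenceSubgroup.Gamma0 (level r)),
      ∃ (s : ℕ) (e : ℕ → ℂ), HasExpansion l (fun τ => etaQuotient r τ *
        cosetValue (contractQuotient r l) (CongruenceSubgroup.Gamma0 (level r)) q τ) e ∧
        (∀ n, Nat.Coprime l n → e (l * n) = s * fourierCoeff r (l * n)) ∧ (q = q₀ → s = 1) := by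
    intro q
    obtain ⟨γ, rfl, hγ1⟩ : ∃ γ : CongruenceSubgroup.Gamma0 (level r), (γ : _ ⧸ _) = q ∧
        (q = q₀ → γ = 1) := by
      by_cases hq : q = q₀
      · exact ⟨1, (hq.trans hq₀).symm, fun _ => rfl⟩
      · obtain ⟨γ, rfl⟩ := QuotientGroup.mk_surjective q
        exact ⟨γ, rfl, fun h => absurd h hq⟩
    simp only [cosetValue_mk]
    by_cases hcop : IsCoprime ((γ : SL(2, ℤ))⁻¹ 0 0) (l : ℤ)
    · obtain ⟨e, he, h⟩ := exists_expansion_of_isCoprime hk hx hhol hl hx1 (inv_mem γ.2) hcop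
      exact ⟨1, e, he, fun n _ => by rw [h, Nat.cast_one, one_mul], fun _ => rfl⟩
    · obtain ⟨e, he, h⟩ := exists_expansion_of_not_isCoprime hk hx hhol hl hsq (inv_mem γ.2) hcop
      refine ⟨0, e, he, fun n hn => by rw [h n hn, Nat.cast_zero, zero_mul], fun hq => ?_⟩
      exfalso
      apply hcop
      rw [hγ1 hq]
      simpa using isCoprime_one_left
  choose s e he hes hs1 using hcoset
  have hexp1 : HasExpansion l (hecke r l) fun m => ∑ q, e q m := by
    have := HasExpansion.sum (s := Finset.univ) fun q _ => he q
    intro τ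
    rw [hecke, traceSum, Finset.mul_sum]
    exact this τ
  have hexp2 : HasExpansion l (hecke r l) fun j =>
      c * (if l ∣ j then fourierCoeff r (j / l) * 1 ^ (j / l) else 0) := by
    rw [hc]
    refine ((hasExpansion_etaQuotient hk hx hhol).comp hl 1 id fun τ => ?_).const_mul c
    have hlC : (l : ℂ) ≠ 0 := by exact_mod_cast hl.ne'
    rw [one_mul, Function.Periodic.qParam, Function.Periodic.qParam, ← Complex.exp_nat_mul]
    congr 1
    push_cast
    simp only [id]
    field_simp
  refine ⟨c, ((∑ q, s q : ℕ) : ℂ), ?_, fun n hn => ?_⟩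
  · have h1 : 0 < s q₀ := by
      rw [hs1 q₀ rfl]
      exact one_pos
    have h2 : s q₀ ≤ ∑ q, s q := Finset.single_le_sum (f := s) (fun _ _ => Nat.zero_le _)
      (Finset.mem_univ q₀)
    exact_mod_cast (h1.trans_le h2).ne'
  -- Both expansions are in exp(2πiτ/l), so the exponent n of q appears as ln.
  · have h := hexp2.unique hl hexp1 (l * n)
    rw [if_pos (dvd_mul_right l n), Nat.mul_div_cancel_left _ hl, one_pow, mul_one] at h
    rw [h, Nat.cast_sum, Finset.sum_mul]
    exact Finset.sum_congr rfl fun q _ => hes q n hn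

end coefficients

/-! ### The sign -/

lemma dvd_of_mem_Lf {r : ℕ+ →₀ ℤ} {l : ℕ} (hl : l ∈ Lf r) :
    (24 : ℤ) ∣ ((l : ℤ) - 1) * xOne r := by
  set g := Nat.gcd 24 (Int.gcd (xOne r) (xN r)) with hg
  have h1 : mf r * g = 24 := Nat.div_mul_cancel (Nat.gcd_dvd_left _ _)
  have h2 : (g : ℤ) ∣ xOne r :=
    (Int.natCast_dvd_natCast.mpr (Nat.gcd_dvd_right _ _)).trans (Int.gcd_dvd_left _ _)
  have h3 : (mf r : ℤ) ∣ (l : ℤ) - 1 := by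
    have := (Nat.modEq_iff_dvd.mp hl.2.1.symm)
    simpa using this
  have h4 : ((mf r : ℤ)) * g = 24 := by exact_mod_cast h1
  rw [← h4]
  exact mul_dvd_mul h3 h2

lemma four_dvd_pow_sub (v m : ℕ) : (4 : ℤ) ∣ ((2 * v + 1 : ℕ) : ℤ) ^ m - (1 + 2 * v * m) := by
  induction m with
  | zero => simp
  | succ m ih =>
    obtain ⟨t, ht⟩ := ih
    refine ⟨(2 * v + 1) * t + v * v * m, ?_⟩
    push_cast at ht ⊢
    rw [pow_succ]
    linear_combination (2 * v + 1 : ℤ) * ht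

/-- Mod 4, u ↦ u - 1 turns products of odd numbers into sums, and takes even values, so only the
parity of e matters and |e| may replace e. -/
lemma four_dvd_sum_sub {ι : Type*} (s : Finset ι) (u : ι → ℕ) (e : ι → ℤ)
    (hu : ∀ i ∈ s, Odd (u i)) :
    (4 : ℤ) ∣ ∑ i ∈ s, (u i : ℤ) * e i - ∑ i ∈ s, e i -
      (((∏ i ∈ s, u i ^ (e i).natAbs : ℕ) : ℤ) - 1) := by
  classical
  induction s using Finset.induction_on with
  | empty => simp
  | insert i s hi ih =>
    have hodd : Odd (∏ j ∈ s, u j ^ (e j).natAbs) :=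
      Finset.prod_induction _ Odd (fun _ _ => Odd.mul) odd_one
        fun j hj => (hu j (Finset.mem_insert_of_mem hj)).pow
    rw [Finset.sum_insert hi, Finset.sum_insert hi, Finset.prod_insert hi]
    obtain ⟨t, ht⟩ := ih fun j hj => hu j (Finset.mem_insert_of_mem hj)
    obtain ⟨v, hv⟩ := hu i (Finset.mem_insert_self i s)
    obtain ⟨w, hw⟩ := hodd
    obtain ⟨y, hy⟩ := four_dvd_pow_sub v (e i).natAbs
    obtain ⟨x, hx⟩ : (2 : ℤ) ∣ e i - (e i).natAbs := by lia
    rw [hw] at ht ⊢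
    rw [hv]
    generalize (e i).natAbs = m at hx hy ⊢
    push_cast at hy ht ⊢
    refine ⟨t + v * x - y * (2 * w + 1) - v * m * w, ?_⟩
    linear_combination ht + (2 * v : ℤ) * hx - (2 * w + 1 : ℤ) * hy

lemma xOne_mod_four {r : ℕ+ →₀ ℤ} (hN : Odd (level r)) :
    (4 : ℤ) ∣ xOne r - twoWeight r - ((bigPi r : ℤ) - 1) ∧ Odd (bigPi r) := by
  have hu : ∀ n ∈ r.support, Odd (level r / n) := fun n hn =>
    hN.of_dvd_nat (Nat.div_dvd_of_dvd (dvd_level hn))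
  exact ⟨four_dvd_sum_sub r.support (fun n => level r / n) r hu,
    Finset.prod_induction _ Odd (fun _ _ => Odd.mul) odd_one fun n hn => (hu n hn).pow⟩

lemma delta_of_odd {r : ℕ+ →₀ ℤ} (h : Odd (bigPi r)) :
    (4 : ℤ) ∣ 2 * delta r - ((bigPi r : ℤ) - 1) := by
  rw [delta]
  split_ifs with h0
  · obtain ⟨α, m, hm⟩ := h0
    rcases Nat.eq_zero_or_pos α with rfl | hα
    · rw [hm]
      exact ⟨-m, by push_cast; ring⟩
    · exfalso
      rw [hm, Nat.odd_mul, Nat.odd_pow_iff hα.ne'] at h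
      exact absurd h.1 (by decide)
  · have h3 : bigPi r % 4 ≠ 3 := by
      intro h3
      exact h0 ⟨0, bigPi r / 4, by lia⟩
    have := Nat.odd_iff.mp h
    lia

/-- If N(k+δ) is odd, then x₁ ≡ 2k + 2δ ≡ 2 mod 4; an even l would make l - 1 odd and force 8 ∣ x₁.
-/
lemma not_even_of_mem_Lf {r : ℕ+ →₀ ℤ} {k : ℤ} (hk : twoWeight r = 2 * k)
    (ht : Odd ((level r : ℤ) * (k + delta r))) {l : ℕ} (hl : l ∈ Lf r) : Odd l := by
  rw [Int.odd_mul] at ht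
  obtain ⟨hN, hs⟩ := ht
  obtain ⟨h1, h2⟩ := xOne_mod_four (by exact_mod_cast hN : Odd (level r))
  have h3 := delta_of_odd h2
  by_contra hodd
  have h4 : (8 : ℤ) ∣ xOne r := by
    have h5 : (8 : ℤ) ∣ ((l : ℤ) - 1) * xOne r := (by norm_num : (8 : ℤ) ∣ 24).trans
      (dvd_of_mem_Lf hl)
    refine IsCoprime.dvd_of_dvd_mul_left ?_ h5
    rw [show (8 : ℤ) = 2 ^ 3 by norm_num]
    apply IsCoprime.pow_left
    rw [Int.prime_two.coprime_iff_not_dvd]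
    rw [Nat.not_odd_iff_even] at hodd
    obtain ⟨m, hm⟩ := hodd
    lia
  obtain ⟨m, hm⟩ := hs
  lia

lemma uSign_eq_one_of_even {N : ℕ} {s : ℤ} (h : Even ((N : ℤ) * s)) (l : ℕ) :
    uSign N s l = 1 := by
  rw [uSign, if_neg]
  rintro ⟨h1, h2⟩
  apply h2
  rw [show (4 : ℤ) = 2 * 2 by norm_num]
  exact mul_dvd_mul h.two_dvd (by lia)

lemma uSign_of_odd {N : ℕ} {s : ℤ} (h : Odd ((N : ℤ) * s)) (m : ℕ) :
    uSign N s (2 * m + 1) = (-1) ^ m := by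
  rw [uSign]
  have h2 : ¬ 2 ∣ 2 * m + 1 := by lia
  have h4 : (4 : ℤ) ∣ (N : ℤ) * s * (((2 * m + 1 : ℕ) : ℤ) - 1) ↔ Even m := by
    obtain ⟨t, ht⟩ := h
    rw [ht]
    push_cast
    rw [show (2 * t + 1) * (2 * (m : ℤ) + 1 - 1) = 4 * (t * m) + 2 * m by ring, even_iff_two_dvd]
    lia
  rcases Nat.even_or_odd m with hm | hm
  · rw [if_neg (fun h => h.2 (h4.mpr hm)), hm.neg_one_pow]
  · rw [if_pos ⟨h2, fun h => Nat.not_even_iff_odd.mpr hm (h4.mp h)⟩, hm.neg_one_pow]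

/-- Either N(k+δ) is even and all signs are 1, or it is odd, both l are odd, and u_l =
(-1)^((l-1)/2) is multiplicative. -/
lemma uSign_mul_uSign {r : ℕ+ →₀ ℤ} {k : ℤ} (hk : twoWeight r = 2 * k) {l₁ l₂ : ℕ}
    (h₁ : l₁ ∈ Lf r) (h₂ : l₂ ∈ Lf r) :
    uSign (level r) (k + delta r) l₁ * uSign (level r) (k + delta r) l₂ *
      uSign (level r) (k + delta r) (l₁ * l₂) = 1 := by
  rcases Int.even_or_odd ((level r : ℤ) * (k + delta r)) with ht | ht
  · simp [uSign_eq_one_of_even ht]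
  · obtain ⟨a, rfl⟩ := not_even_of_mem_Lf hk ht h₁
    obtain ⟨b, rfl⟩ := not_even_of_mem_Lf hk ht h₂
    rw [show (2 * a + 1) * (2 * b + 1) = 2 * (a + b + 2 * (a * b)) + 1 by ring, uSign_of_odd ht,
      uSign_of_odd ht, uSign_of_odd ht, ← pow_add, ← pow_add]
    exact Even.neg_one_pow ⟨a + b + a * b, by ring⟩

end EtaQuotient

end

/-! ### The theorem -/

theorem proposition9p12 (r : ℕ+ →₀ ℤ) (hadm : EtaQuotient.IsWeaklyAdmissible r)
    (k : ℤ) (hk : EtaQuotient.weight r = (k : ℚ))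
    (x : ℕ) (hx : EtaQuotient.xN r = 24 * (x : ℤ)) :
    (∀ τ : UpperHalfPlane,
      HasSum (fun n : ℕ => EtaQuotient.fourierCoeff r n *
          Complex.exp (2 * (Real.pi : ℂ) * Complex.I * (n : ℂ) * (τ : ℂ)))
        (EtaQuotient.etaQuotient r τ)) ∧
    ∀ l₁ ∈ EtaQuotient.Lf r, ∀ l₂ ∈ EtaQuotient.Lf r,
      Nat.Coprime l₁ l₂ → Nat.Coprime l₁ x → Nat.Coprime l₂ x →
      (∀ p : ℕ, p.Prime → ¬ p ∣ EtaQuotient.level r → ¬ p ^ 2 ∣ l₁) →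
      (∀ p : ℕ, p.Prime → ¬ p ∣ EtaQuotient.level r → ¬ p ^ 2 ∣ l₂) →
      ((EtaQuotient.level r ≡ 0 [MOD 2] ∧
          (EtaQuotient.level r : ℤ) * (k + EtaQuotient.delta r) ≡ 2 [ZMOD 4]) →
        l₁ ≡ 1 [MOD 2] ∧ l₂ ≡ 1 [MOD 2]) →
      EtaQuotient.fourierCoeff r (l₁ * x) * EtaQuotient.fourierCoeff r (l₂ * x) =
        ((EtaQuotient.uSign (EtaQuotient.level r) (k + EtaQuotient.delta r) l₁ *
            EtaQuotient.uSign (EtaQuotient.level r) (k + EtaQuotient.delta r) l₂ *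
            EtaQuotient.uSign (EtaQuotient.level r) (k + EtaQuotient.delta r) (l₁ * l₂) : ℤ) : ℂ) *
          EtaQuotient.fourierCoeff r (l₁ * l₂ * x) := by
  have hk2 : EtaQuotient.twoWeight r = 2 * k := by
    rw [EtaQuotient.weight, div_eq_iff two_ne_zero] at hk
    rw [mul_comm]
    exact_mod_cast hk
  have hx24 : 24 ∣ EtaQuotient.xN r := ⟨x, hx⟩
  refine ⟨fun τ => ?_, fun l₁ h₁ l₂ h₂ h₁₂ h₁x h₂x hsq₁ hsq₂ hodd => ?_⟩
  · have h := EtaQuotient.hasExpansion_etaQuotient hk2 hx24 hadm.1 τ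
    refine h.congr_fun fun n => ?_
    rw [smul_eq_mul, Function.Periodic.qParam, ← Complex.exp_nat_mul]
    congr 2
    push_cast
    ring
  · obtain ⟨c, K, hK, hrel⟩ := EtaQuotient.exists_fourierCoeff_relation hk2 hx24 hadm h₁.1
      (EtaQuotient.dvd_of_mem_Lf h₁) hsq₁
    -- As c_f(x) = 1, this identifies the eigenvalue: c = K·c_f(l₁x). The next instance then gives
    -- the product.
    have e1 := hrel x h₁x
    have e2 := hrel (l₂ * x) (h₁₂.mul_right h₁x)
    rw [EtaQuotient.fourierCoeff_leading hk2 hx hadm.1, mul_one] at e1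
    rw [e1, mul_assoc, ← mul_assoc l₁] at e2
    rw [EtaQuotient.uSign_mul_uSign hk2 h₁ h₂, Int.cast_one, one_mul]
    exact mul_left_cancel₀ hK e2
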